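/- For $0<p<\infty$ and $\alpha>-1$, let $\mathcal D^p_\alpha$ be the space of functions $f$ analytic in the open unit disc $\mathbb D$ with $$\|f\|_{\mathcal D^p_\alpha}=|f(0)|+\Big((\alpha+1)\int_{\mathbb D}|f'(z)|^p(1-|z|^2)^\alpha\,dA(z)\Big)^{1/p}<\infty,$$ where $dA$ is the area measure on $\mathbb D$ normalized so that $\mathbb D$ has area $1$. For $s>0$, a positive Borel measure $\mu$ on $[0,1)$ is called an $s$-Carleson measure if there is a constant $C>0$ with $\mu([t,1))\le C(1-t)^s$ for all $0\le t<1$. For $\beta>0$ and $f(z)=\sum_{k\ge0}a_kz^k$ analytic in $\mathbb D$, let $$\mathcal H_{\mu,\beta}(f)(z)=\sum_{n=0}^\infty\Big(\sum_{k=0}^\infty\mu_{n,k,\beta}\,a_k\Big)z^n,\qquad \mu_{n,k,\beta}=\int_{[0,1)}\frac{\Gamma(n+\beta)}{n!\,\Gamma(\beta)}\,t^{n+k}\,d\mu(t),$$ whenever all these series converge for every $z\in\mathbb D$. We say that $\mathcal H_{\mu,\beta}$ is bounded from $\mathcal D^p_\alpha$ into $\mathcal D^q_\gamma$ if $\mathcal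 H_{\mu,\beta}(f)$ is well defined and belongs to $\mathcal D^q_\gamma$ for every $f\in\mathcal D^p_\alpha$, and there is a constant $C$ with $\|\mathcal H_{\mu,\beta}(f)\|_{\mathcal D^q_\gamma}\le C\|f\|_{\mathcal D^p_\alpha}$ for all such $f$. **Theorem.** Let $1<q<\infty$, $1/q+1/q'=1$, $0<p\le q$, $\alpha>p-1$ and $\beta>q$. Let $\mu$ be a positive Borel measure on $[0,1)$ which is a $\frac{\alpha+2}{p}$-Carleson measure if $0<p\le1$, a $\frac{\alpha+2-(p-1)^2}{p}$-Carleson measure if $1\le p\le2$, and a $\frac{\alpha+1}{p}$-Carleson measure if $p\ge2$. (i) If $\mathcal H_{\mu,\beta}$ is bounded from $\mathcal D^p_\alpha$ into $\mathcal D^q_{\beta-1}$, then $\mu$ is a $\left(\frac{\alpha+2}{p}+\frac{\beta+1}{q'}-1\right)$-Carleson measure. (ii) If $\mu$ is a $\left(\max\{\alpha+2-p,\beta+1\}\left(\frac1p+\frac1{q'}\right)\right)$-Carleson measure, then $\mathcal H_{\mu,\beta}$ is bounded from $\mathcal D^p_\alpha$ into $\mathcal D^q_{\beta-1}$. -/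

import Mathlib

open scoped ENNReal NNReal Topology

noncomputable section

namespace GenHilbert

/-- The open unit disc of the complex plane. -/
def unitDisc : Set ℂ := Metric.ball 0 1

/-- Area measure on the unit disc, normalized so that the total area of the disc is `1`. -/
def areaMeasure : MeasureTheory.Measure ℂ :=
  ENNReal.ofReal (Real.pi)⁻¹ • (MeasureTheory.volume.restrict unitDisc)

/-- The quantity `((α + 1) ∫_𝔻 |f(z)|^p (1 - |z|²)^α dA(z))^(1/p)`, with values in `[0, ∞]`. -/
def bergmanNorm (p α : ℝ) (f : ℂ → ℂ) : ℝ≥0∞ :=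
  (ENNReal.ofReal (α + 1) *
    ∫⁻ z, ENNReal.ofReal (‖f z‖ ^ p * (1 - ‖z‖ ^ 2) ^ α) ∂areaMeasure) ^ (1 / p)

/-- The quantity `|f(0)| + ((α + 1) ∫_𝔻 |f'(z)|^p (1 - |z|²)^α dA(z))^(1/p)`, with values in
`[0, ∞]`. -/
def dirichletNorm (p α : ℝ) (f : ℂ → ℂ) : ℝ≥0∞ :=
  ENNReal.ofReal ‖f 0‖ + bergmanNorm p α (deriv f)

/-- `f` belongs to the space of Dirichlet type `𝓓^p_α`: it is analytic in the unit disc and its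
norm is finite. Only the values of `f` in the unit disc matter. -/
def MemDirichlet (p α : ℝ) (f : ℂ → ℂ) : Prop :=
  DifferentiableOn ℂ f unitDisc ∧ dirichletNorm p α f < ∞

/-- The `k`-th Taylor coefficient of `f` at `0`. -/
def taylorCoeff (f : ℂ → ℂ) (k : ℕ) : ℂ :=
  iteratedDeriv k f 0 / (k.factorial : ℂ)

/-- The entry `μ_{n,k,β} = ∫_{[0,1)} Γ(n+β) / (n! Γ(β)) t^(n+k) dμ(t)` of the generalized Hankel
matrix. -/
def hankelEntry (μ : MeasureTheory.Measure (Set.Ico (0 : ℝ) 1)) (β : ℝ) (n k : ℕ) : ℝ :=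
  ∫ t, Real.Gamma (n + β) / (n.factorial * Real.Gamma β) * (t : ℝ) ^ (n + k) ∂μ

/-- `𝓗_{μ,β}(f)` is well defined and equal to `g` in the unit disc: writing `a_k` for the Taylor
coefficients of `f`, every series `∑_k μ_{n,k,β} a_k` converges, with sum `c n` say, and for every
`z` in the disc the power series `∑_n c_n z^n` converges to `g z`. -/
def IsHilbertImage (μ : MeasureTheory.Measure (Set.Ico (0 : ℝ) 1)) (β : ℝ) (f g : ℂ → ℂ) : Prop :=
  ∃ c : ℕ → ℂ,
    (∀ n, Filter.Tendsto
      (fun N => ∑ k ∈ Finset.range N, (hankelEntry μ β n k : ℂ) * taylorCoeff f k)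
      Filter.atTop (𝓝 (c n))) ∧
    ∀ z ∈ unitDisc, HasSum (fun n => c n * z ^ n) (g z)

/-- `𝓗_{μ,β}` is a bounded operator from `𝓓^p_α` into `𝓓^q_γ`: it is well defined on all of
`𝓓^p_α`, takes values in `𝓓^q_γ`, and `‖𝓗_{μ,β} f‖ ≤ C ‖f‖` with a finite constant `C`. -/
def HilbertBounded (μ : MeasureTheory.Measure (Set.Ico (0 : ℝ) 1)) (β p α q γ : ℝ) : Prop :=
  ∃ C : ℝ≥0, ∀ f : ℂ → ℂ, MemDirichlet p α f →
    ∃ g : ℂ → ℂ, IsHilbertImage μ β f g ∧ MemDirichlet q γ g ∧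
      dirichletNorm q γ g ≤ C * dirichletNorm p α f

/-- A positive Borel measure `μ` on `[0,1)` is `s`-Carleson if `μ([t,1)) ≤ C (1-t)^s` for all
`0 ≤ t < 1`, for some positive constant `C`. -/
def IsCarleson (s : ℝ) (μ : MeasureTheory.Measure (Set.Ico (0 : ℝ) 1)) : Prop :=
  ∃ C : ℝ, 0 < C ∧ ∀ t : ℝ, 0 ≤ t → t < 1 →
    μ {x : Set.Ico (0 : ℝ) 1 | t ≤ (x : ℝ)} ≤ ENNReal.ofReal (C * (1 - t) ^ s)

/-- The standing condition on `μ` for the parameters `p`, `α`: `μ` is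
`(α+2)/p`-Carleson if `0 < p ≤ 1`, `(α+2-(p-1)²)/p`-Carleson if `1 ≤ p ≤ 2`, and
`(α+1)/p`-Carleson if `2 ≤ p`. (The exponents agree at `p = 1` and at `p = 2`.) -/
def StandingCondition (p α : ℝ) (μ : MeasureTheory.Measure (Set.Ico (0 : ℝ) 1)) : Prop :=
  (0 < p → p ≤ 1 → IsCarleson ((α + 2) / p) μ) ∧
  (1 ≤ p → p ≤ 2 → IsCarleson ((α + 2 - (p - 1) ^ 2) / p) μ) ∧
  (2 ≤ p → IsCarleson ((α + 1) / p) μ)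

end GenHilbert

end

namespace GenHilbert

open MeasureTheory Set

/-! Summing the binomial series in `n` turns the operator into `g(z) = ∫ f(t) (1 - t z)^(-β) dμ(t)`,
so that `g'(z) = β ∫ t f(t) (1 - t z)^(-(β+1)) dμ(t)`. Both halves of the theorem are read off from
this formula.

Sufficiency. Put `P = 1 + p/q'`, with conjugate exponent `Q = 1 + q'/p`; then `p ≤ P ≤ q`. The map
`f ↦ g'` factors through `L^P(μ)`. The restriction of `𝓓^p_α` to the radius embeds in `L^P(μ)` when
`μ` is `P(α+2-p)/p`-Carleson (`lintegral_norm_rpow_le_dirichletNorm`). The positive operator with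
kernel `|1 - t z|^(-(β+1))` maps `L^P(μ)` into the weighted `L^q` when `μ` is `Q(β+1)/q'`-Carleson
(`lintegral_kernel_rpow_le`). These orders are `α+2-p` and `β+1` times `1/p + 1/q'`, which explains
the maximum in the hypothesis. The embedding samples `f'` at dyadic points of the radius, compares
the samples with the area integral by a local mean value estimate, and sums the increments with a
discrete Hardy inequality. The kernel bound is a Schur test: Hölder with an auxiliary power of `1 -
t`, Tonelli, and the Forelli–Rudin estimate.

Necessity. Test on `f(z) = (1 - b z)^(-m)` with `m` large. Everything is positive at the point `b`,
so `g'(b)` is at least a constant times `(1-b)^(-(m+β+1)) μ([b,1))`, while pointwise growth in the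
target space bounds `|g'(b)|` by a constant times `(1-b)^(-(β+1)/q) ‖f‖`. With `‖f‖` at most a
constant times `(1-b)^((α+2)/p-m-1)`, the powers of `1 - b` give the stated order. -/

/-! ### Power integrals on the half-line and against Carleson measures -/

/-- Split at `v = d`: below, `d + v` is replaced by `d` and `a > 0` gives integrability at `0`;
above, it is replaced by `v` and `a < N` gives integrability at infinity. -/
theorem lintegral_add_rpow_mul_rpow_le {a N : ℝ} (ha : 0 < a) (hN : a < N) :
    ∃ C : ℝ≥0∞, C ≠ ∞ ∧ ∀ d : ℝ, 0 < d →
      ∫⁻ v in Ioi (0 : ℝ), ENNReal.ofReal ((d + v) ^ (-N) * v ^ (a - 1)) ≤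
        C * ENNReal.ofReal (d ^ (a - N)) := by
  refine ⟨ENNReal.ofReal (1 / a + 1 / (N - a)), ENNReal.ofReal_ne_top, fun d hd => ?_⟩
  have hNa : 0 < N - a := sub_pos.2 hN
  have h1 : ∫⁻ v in Ioc (0 : ℝ) d, ENNReal.ofReal ((d + v) ^ (-N) * v ^ (a - 1)) ≤
      ENNReal.ofReal (1 / a * d ^ (a - N)) := by
    calc ∫⁻ v in Ioc (0 : ℝ) d, ENNReal.ofReal ((d + v) ^ (-N) * v ^ (a - 1))
        ≤ ∫⁻ v in Ioc (0 : ℝ) d, ENNReal.ofReal (d ^ (-N) * v ^ (a - 1)) := by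
          refine setLIntegral_mono' measurableSet_Ioc fun v hv => ENNReal.ofReal_le_ofReal ?_
          refine mul_le_mul_of_nonneg_right ?_ (Real.rpow_nonneg hv.1.le _)
          exact Real.rpow_le_rpow_of_nonpos hd (by linarith [hv.1]) (by linarith)
      _ = ENNReal.ofReal (∫ v in Ioc (0 : ℝ) d, d ^ (-N) * v ^ (a - 1)) := by
          refine (ofReal_integral_eq_lintegral_ofReal ?_ ?_).symm
          · have := (intervalIntegral.intervalIntegrable_rpow' (a := 0) (b := d)
              (show -1 < a - 1 by linarith)).const_mul (d ^ (-N))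
            exact (intervalIntegrable_iff_integrableOn_Ioc_of_le hd.le).1 this
          · filter_upwards [ae_restrict_mem measurableSet_Ioc] with v hv
            exact mul_nonneg (Real.rpow_nonneg hd.le _) (Real.rpow_nonneg hv.1.le _)
      _ = ENNReal.ofReal (1 / a * d ^ (a - N)) := by
          rw [← intervalIntegral.integral_of_le hd.le, intervalIntegral.integral_const_mul,
            integral_rpow (Or.inl (by linarith)), sub_add_cancel, Real.zero_rpow ha.ne', sub_zero,
            show a - N = -N + a by ring, Real.rpow_add hd]
          congr 1; ring
  have h2 : ∫⁻ v in Ioi d, ENNReal.ofReal ((d + v) ^ (-N) * v ^ (a - 1)) ≤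
      ENNReal.ofReal (1 / (N - a) * d ^ (a - N)) := by
    calc ∫⁻ v in Ioi d, ENNReal.ofReal ((d + v) ^ (-N) * v ^ (a - 1))
        ≤ ∫⁻ v in Ioi d, ENNReal.ofReal (v ^ (a - 1 - N)) := by
          refine setLIntegral_mono' measurableSet_Ioi fun v hv => ENNReal.ofReal_le_ofReal ?_
          have hv0 : 0 < v := hd.trans hv
          rw [show a - 1 - N = -N + (a - 1) by ring, Real.rpow_add hv0]
          refine mul_le_mul_of_nonneg_right ?_ (Real.rpow_nonneg hv0.le _)
          exact Real.rpow_le_rpow_of_nonpos hv0 (by linarith) (by linarith)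
      _ = ENNReal.ofReal (∫ v in Ioi d, v ^ (a - 1 - N)) := by
          refine (ofReal_integral_eq_lintegral_ofReal ?_ ?_).symm
          · exact integrableOn_Ioi_rpow_of_lt (by linarith) hd
          · filter_upwards [ae_restrict_mem measurableSet_Ioi] with v hv
            exact Real.rpow_nonneg (hd.trans hv).le _
      _ = ENNReal.ofReal (1 / (N - a) * d ^ (a - N)) := by
          rw [integral_Ioi_rpow_of_lt (by linarith) hd]
          congr 1
          rw [show a - 1 - N + 1 = -(N - a) by ring, neg_div_neg_eq, neg_sub, div_mul_eq_mul_div,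
            one_mul]
  rw [← Ioc_union_Ioi_eq_Ioi hd.le]
  refine (lintegral_union_le _ _ _).trans ((add_le_add h1 h2).trans_eq ?_)
  rw [← ENNReal.ofReal_add (by positivity) (by positivity), ← ENNReal.ofReal_mul (by positivity)]
  congr 1; ring

theorem IsCarleson.isFiniteMeasure {s : ℝ} {μ : Measure (Ico (0 : ℝ) 1)} (h : IsCarleson s μ) :
    IsFiniteMeasure μ := by
  obtain ⟨C, -, h⟩ := h
  refine ⟨lt_of_le_of_lt ?_ (ENNReal.ofReal_lt_top (r := C * (1 - 0) ^ s))⟩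
  rw [← eq_univ_of_forall (s := {x : Ico (0 : ℝ) 1 | 0 ≤ (x : ℝ)}) fun x => x.2.1]
  exact h 0 le_rfl one_pos

theorem IsCarleson.mono {s s' : ℝ} {μ : Measure (Ico (0 : ℝ) 1)} (h : IsCarleson s μ)
    (hs : s' ≤ s) : IsCarleson s' μ := by
  obtain ⟨C, hC, h⟩ := h
  refine ⟨C, hC, fun t ht ht1 => (h t ht ht1).trans (ENNReal.ofReal_le_ofReal ?_)⟩
  exact mul_le_mul_of_nonneg_left
    (Real.rpow_le_rpow_of_exponent_ge (by linarith) (by linarith) hs) hC.le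

/-- For `v > 1` the total mass is at most `C ≤ C v^s`, so the Carleson bound holds at every scale,
as the layer-cake argument below requires. -/
theorem IsCarleson.measure_le {s : ℝ} {μ : Measure (Ico (0 : ℝ) 1)} (h : IsCarleson s μ)
    (hs : 0 ≤ s) : ∃ C : ℝ, 0 < C ∧ ∀ v : ℝ, 0 < v →
      μ {x : Ico (0 : ℝ) 1 | 1 - (x : ℝ) ≤ v} ≤ ENNReal.ofReal (C * v ^ s) := by
  obtain ⟨C, hC, h⟩ := h
  refine ⟨C, hC, fun v hv => ?_⟩
  rcases le_or_gt v 1 with h1 | h1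
  · refine le_trans (measure_mono ?_) ((h (1 - v) (by linarith) (by linarith)).trans_eq ?_)
    · intro x hx
      simp only [mem_ofPred_eq] at hx ⊢
      linarith
    · rw [sub_sub_cancel]
  · refine le_trans (measure_mono ?_) ((h 0 le_rfl one_pos).trans (ENNReal.ofReal_le_ofReal ?_))
    · intro x _
      exact x.2.1
    · rw [sub_zero, Real.one_rpow]
      exact mul_le_mul_of_nonneg_left (Real.one_le_rpow h1.le hs) hC.le

/-- A layer-cake argument without derivatives: with `u = 1 - t`, the integrand at `u` is at most a
constant times the integral of `(d + v)^(-N) v^(-e-1)` over `[u, 2u]`. After Tonelli the inner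
integral is `μ {1 - t ≤ v}`, at most a constant times `v^s`, and the half-line estimate with `a = s
- e` finishes. -/
theorem IsCarleson.lintegral_le {s e N : ℝ} {μ : Measure (Ico (0 : ℝ) 1)} (h : IsCarleson s μ)
    (he : 0 ≤ e) (hes : e < s) (hN : s - e < N) :
    ∃ C : ℝ≥0∞, C ≠ ∞ ∧ ∀ d : ℝ, 0 < d →
      ∫⁻ t : Ico (0 : ℝ) 1, ENNReal.ofReal ((d + (1 - (t : ℝ))) ^ (-N) * (1 - (t : ℝ)) ^ (-e)) ∂μ ≤
        C * ENNReal.ofReal (d ^ (s - e - N)) := by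
  have := h.isFiniteMeasure
  obtain ⟨A, hA, hμ⟩ := h.measure_le (by linarith)
  obtain ⟨B, hB, hint⟩ := lintegral_add_rpow_mul_rpow_le (sub_pos.2 hes) hN
  have hN0 : 0 < N := by linarith
  refine ⟨ENNReal.ofReal (2 ^ (N + e + 1)) * (ENNReal.ofReal A * B), by finiteness, fun d hd => ?_⟩
  set F : ℝ → ℝ := fun v => (d + v) ^ (-N) * v ^ (-e - 1) with hF
  have hFm : Measurable F := by fun_prop
  have hpt (t : Ico (0 : ℝ) 1) :
      ENNReal.ofReal ((d + (1 - (t : ℝ))) ^ (-N) * (1 - (t : ℝ)) ^ (-e)) ≤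
      ENNReal.ofReal (2 ^ (N + e + 1)) * ∫⁻ v in Ioi (0 : ℝ),
        {p : Ico (0 : ℝ) 1 × ℝ | 1 - (p.1 : ℝ) ≤ p.2}.indicator
          (fun p => ENNReal.ofReal (F p.2)) (t, v) := by
    obtain ⟨t, ht0, ht1⟩ := t
    obtain ⟨u, hu⟩ : ∃ u, u = 1 - t := ⟨_, rfl⟩
    have hu0 : 0 < u := by linarith
    simp only [← hu]
    -- On `[u, 2u]`, an interval of length `u`, the integrand in `v` is at least its value with `d +
    -- u` and `u` doubled; undoing the doubling costs `2^(N+e+1)`.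
    calc ENNReal.ofReal ((d + u) ^ (-N) * u ^ (-e))
        = ENNReal.ofReal (2 ^ (N + e + 1)) *
          (ENNReal.ofReal ((2 * (d + u)) ^ (-N) * (2 * u) ^ (-e - 1)) * volume (Icc u (2 * u))) := by
          rw [Real.volume_Icc, ← ENNReal.ofReal_mul (by positivity),
            ← ENNReal.ofReal_mul (by positivity)]
          congr 1
          rw [Real.mul_rpow zero_le_two (by positivity), Real.mul_rpow zero_le_two hu0.le,
            show 2 * u - u = u by ring, show N + e + 1 = -(-N + (-e - 1)) by ring,
            Real.rpow_neg zero_le_two, Real.rpow_add two_pos, Real.rpow_sub hu0, Real.rpow_one]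
          have h2 : (2 : ℝ) ^ (-N) ≠ 0 := by positivity
          have h3 : (2 : ℝ) ^ (-e - 1) ≠ 0 := by positivity
          field_simp
      _ ≤ _ := by
          gcongr
          rw [← setLIntegral_const]
          calc _ ≤ ∫⁻ v in Icc u (2 * u), {p : Ico (0 : ℝ) 1 × ℝ | 1 - (p.1 : ℝ) ≤ p.2}.indicator
                (fun p => ENNReal.ofReal (F p.2)) (⟨t, ht0, ht1⟩, v) := by
                refine setLIntegral_mono' measurableSet_Icc fun v hv => ?_
                rw [indicator_of_mem (by simp only [mem_ofPred_eq, ← hu]; exact hv.1)]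
                refine ENNReal.ofReal_le_ofReal ?_
                have hv0 : 0 < v := hu0.trans_le hv.1
                refine mul_le_mul ?_ ?_ (by positivity) (by positivity)
                · exact Real.rpow_le_rpow_of_nonpos (by positivity) (by linarith [hv.2]) (by linarith)
                · exact Real.rpow_le_rpow_of_nonpos hv0 hv.2 (by linarith)
            _ ≤ _ := lintegral_mono_set fun v hv => hu0.trans_le hv.1
  have hS : MeasurableSet {p : Ico (0 : ℝ) 1 × ℝ | 1 - (p.1 : ℝ) ≤ p.2} :=
    measurableSet_le (by fun_prop) (by fun_prop)
  have hm : Measurable ({p : Ico (0 : ℝ) 1 × ℝ | 1 - (p.1 : ℝ) ≤ p.2}.indicator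
          (fun p => ENNReal.ofReal (F p.2))) :=
    Measurable.indicator (by fun_prop) hS
  calc _ ≤ _ := lintegral_mono hpt
    _ = ENNReal.ofReal (2 ^ (N + e + 1)) * ∫⁻ v in Ioi (0 : ℝ), ∫⁻ t,
        {p : Ico (0 : ℝ) 1 × ℝ | 1 - (p.1 : ℝ) ≤ p.2}.indicator
          (fun p => ENNReal.ofReal (F p.2)) (t, v) ∂μ := by
        rw [lintegral_const_mul' _ _ ENNReal.ofReal_ne_top, lintegral_lintegral_swap (f := fun t v =>
          {p : Ico (0 : ℝ) 1 × ℝ | 1 - (p.1 : ℝ) ≤ p.2}.indicator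
          (fun p => ENNReal.ofReal (F p.2)) (t, v)) hm.aemeasurable]
    _ ≤ ENNReal.ofReal (2 ^ (N + e + 1)) * ∫⁻ v in Ioi (0 : ℝ), ENNReal.ofReal A *
          ENNReal.ofReal ((d + v) ^ (-N) * v ^ (s - e - 1)) := by
        refine mul_le_mul' le_rfl (setLIntegral_mono' measurableSet_Ioi fun v (hv : 0 < v) => ?_)
        have : ∀ t : Ico (0 : ℝ) 1, {p : Ico (0 : ℝ) 1 × ℝ | 1 - (p.1 : ℝ) ≤ p.2}.indicator
          (fun p => ENNReal.ofReal (F p.2)) (t, v) =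
            {t : Ico (0 : ℝ) 1 | 1 - (t : ℝ) ≤ v}.indicator (fun _ => ENNReal.ofReal (F v)) t :=
          fun t => rfl
        simp_rw [this]
        rw [lintegral_indicator_const (measurableSet_le (by fun_prop) (by fun_prop))]
        refine (mul_le_mul' le_rfl (hμ v hv)).trans_eq ?_
        rw [← ENNReal.ofReal_mul (by positivity), ← ENNReal.ofReal_mul hA.le]
        congr 1
        rw [hF, show s - e - 1 = s + (-e - 1) by ring, Real.rpow_add hv]
        ring
    _ ≤ _ := by
        rw [lintegral_const_mul' _ _ ENNReal.ofReal_ne_top, mul_assoc, mul_assoc]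
        gcongr
        exact hint d hd

/-! ### Area integrals on the disc and the Forelli–Rudin estimate -/

theorem mem_unitDisc {z : ℂ} : z ∈ unitDisc ↔ ‖z‖ < 1 := by
  simp [unitDisc]

theorem isOpen_unitDisc : IsOpen unitDisc := Metric.isOpen_ball

theorem measurableSet_unitDisc : MeasurableSet unitDisc := isOpen_unitDisc.measurableSet

theorem one_sub_norm_sq_pos {z : ℂ} (hz : z ∈ unitDisc) : 0 < 1 - ‖z‖ ^ 2 := by
  have := mem_unitDisc.1 hz
  nlinarith [norm_nonneg z]

theorem ae_mem_unitDisc : ∀ᵐ z ∂areaMeasure, z ∈ unitDisc :=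
  Measure.ae_smul_measure (ae_restrict_mem measurableSet_unitDisc) _

instance : SFinite areaMeasure := by
  unfold areaMeasure
  infer_instance

theorem lintegral_areaMeasure_le (F : ℂ → ℝ≥0∞) :
    ∫⁻ z, F z ∂areaMeasure ≤ ∫⁻ z in unitDisc, F z := by
  rw [areaMeasure, lintegral_smul_measure, smul_eq_mul]
  refine mul_le_of_le_one_left' ?_
  rw [ENNReal.ofReal_le_one]
  exact inv_le_one_of_one_le₀ (by linarith [Real.pi_gt_three])

theorem setLIntegral_le_areaMeasure {E : Set ℂ} (hE : E ⊆ unitDisc) (F : ℂ → ℝ≥0∞) :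
    ∫⁻ z in E, F z ≤ ENNReal.ofReal Real.pi * ∫⁻ z in E, F z ∂areaMeasure := by
  rw [areaMeasure, Measure.restrict_smul, lintegral_smul_measure, smul_eq_mul, ← mul_assoc,
    ← ENNReal.ofReal_mul Real.pi_pos.le, mul_inv_cancel₀ Real.pi_pos.ne', ENNReal.ofReal_one,
    one_mul, Measure.restrict_restrict_of_subset hE]

theorem setLIntegral_unitDisc_eq_polar {F : ℂ → ℝ≥0∞} (hF : Measurable (unitDisc.indicator F)) :
    ∫⁻ z in unitDisc, F z = ∫⁻ r in Ioo (0 : ℝ) 1, ∫⁻ θ in Ioo (-Real.pi) Real.pi,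
      ENNReal.ofReal r * F (r * (Real.cos θ + Real.sin θ * Complex.I)) := by
  rw [← lintegral_indicator measurableSet_unitDisc, ← Complex.lintegral_comp_polarCoord_symm,
    polarCoord_target, Measure.volume_eq_prod, ← Measure.prod_restrict,
    lintegral_prod]
  · have hIoo : Ioo (0 : ℝ) 1 = Iio 1 ∩ Ioi 0 := by ext; simp [and_comm]
    rw [hIoo, ← Measure.restrict_restrict measurableSet_Iio,
      ← lintegral_indicator measurableSet_Iio]
    refine setLIntegral_congr_fun measurableSet_Ioi fun r (hr : 0 < r) => ?_
    have hmem (θ : ℝ) : (r : ℂ) * (Real.cos θ + Real.sin θ * Complex.I) ∈ unitDisc ↔ r < 1 := by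
      rw [mem_unitDisc, ← Complex.polarCoord_symm_apply (r, θ), Complex.norm_polarCoord_symm,
        abs_of_pos hr]
    by_cases h1 : r < 1
    · rw [indicator_of_mem (show r ∈ Iio 1 from h1)]
      refine lintegral_congr fun θ => ?_
      rw [Complex.polarCoord_symm_apply, indicator_of_mem ((hmem θ).2 h1), smul_eq_mul]
    · rw [indicator_of_notMem (show r ∉ Iio 1 from h1)]
      refine (lintegral_congr fun θ => ?_).trans lintegral_zero
      rw [Complex.polarCoord_symm_apply, indicator_of_notMem (fun h => h1 ((hmem θ).1 h)), smul_zero]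
  · refine Measurable.aemeasurable ?_
    simp only [Complex.polarCoord_symm_apply, smul_eq_mul]
    refine Measurable.mul (by fun_prop) (hF.comp ?_)
    fun_prop

/-- The squared norm is `(1-ρ)² + 2ρ(1 - cos θ)`, and `1 - cos θ ≥ θ²/8` on `[-π, π]`. For `ρ ≤ 1/2`
the first term suffices since `|θ| ≤ 4`; otherwise both terms are used. -/
theorem norm_one_sub_mul_exp_ge {ρ θ : ℝ} (h0 : 0 ≤ ρ) (h1 : ρ ≤ 1) (hθ : |θ| ≤ Real.pi) :
    (1 - ρ + |θ|) / 10 ≤ ‖1 - (ρ : ℂ) * (Real.cos θ + Real.sin θ * Complex.I)‖ := by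
  have hcos := Real.cos_le_one_sub_mul_cos_sq hθ
  have hpi := Real.pi_pos
  have hpi4 := Real.pi_le_four
  have hsq : ‖1 - (ρ : ℂ) * (Real.cos θ + Real.sin θ * Complex.I)‖ ^ 2 =
      (1 - ρ) ^ 2 + 2 * ρ * (1 - Real.cos θ) := by
    rw [Complex.sq_norm, Complex.normSq_apply]
    simp
    have := Real.sin_sq_add_cos_sq θ
    norm_cast
    linear_combination ρ ^ 2 * this
  have hθ2 : θ ^ 2 / 8 ≤ 1 - Real.cos θ := by
    have : θ ^ 2 / 8 ≤ 2 / Real.pi ^ 2 * θ ^ 2 := by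
      rw [div_mul_eq_mul_div, div_le_div_iff₀ (by norm_num) (by positivity)]
      nlinarith [sq_nonneg θ, mul_nonneg (sq_nonneg θ) (show 0 ≤ 16 - Real.pi ^ 2 by nlinarith)]
    linarith
  have habs : |θ| ≤ 4 := hθ.trans hpi4
  refine le_of_sq_le_sq ?_ (norm_nonneg _)
  rw [hsq]
  have ha := abs_nonneg θ
  rw [← sq_abs θ] at hθ2
  rcases le_or_gt ρ (1 / 2) with h | h
  · have : 0 ≤ 2 * ρ * (1 - Real.cos θ) := by
      have := Real.cos_le_one θ
      have : 0 ≤ 1 - Real.cos θ := by linarith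
      positivity
    nlinarith
  · nlinarith [sq_nonneg (1 - ρ - |θ|)]

/-- Exchanges comparable weights, such as `1 - |z|` and `1 - |z|²`, under an exponent of either
sign. -/
theorem rpow_le_three_rpow_mul {x y : ℝ} (a : ℝ) (hx : 0 < x) (hxy : x ≤ 3 * y) (hyx : y ≤ 3 * x) :
    x ^ a ≤ 3 ^ |a| * y ^ a := by
  have hy : 0 < y := by linarith
  rcases le_total 0 a with h | h
  · rw [abs_of_nonneg h, ← Real.mul_rpow (by norm_num) hy.le]
    exact Real.rpow_le_rpow hx.le hxy h
  · rw [abs_of_nonpos h, Real.rpow_neg (by norm_num), ← Real.inv_rpow (by norm_num),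
      ← Real.mul_rpow (by norm_num) hy.le]
    exact Real.rpow_le_rpow_of_nonpos (by positivity) (by linarith) h

/-- The upper half of the Forelli–Rudin estimates. -/
theorem lintegral_norm_one_sub_mul_rpow_le {a M : ℝ} (ha : -1 < a) (hM : a + 2 < M) :
    ∃ C : ℝ≥0∞, C ≠ ∞ ∧ ∀ t : ℝ, 0 ≤ t → t < 1 →
      ∫⁻ z, ENNReal.ofReal (‖1 - t * z‖ ^ (-M) * (1 - ‖z‖ ^ 2) ^ a) ∂areaMeasure ≤
        C * ENNReal.ofReal ((1 - t) ^ (a + 2 - M)) := by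
  obtain ⟨B, hB, hint⟩ := lintegral_add_rpow_mul_rpow_le one_pos (show 1 < M by linarith)
  obtain ⟨B', hB', hint'⟩ := lintegral_add_rpow_mul_rpow_le (show 0 < a + 1 by linarith)
    (show a + 1 < M - 1 by linarith)
  refine ⟨ENNReal.ofReal (20 ^ M * 3 ^ |a|) * (2 * B) * B', by finiteness, fun t ht0 ht1 => ?_⟩
  set δ := 1 - t with hδ
  have hδ0 : 0 < δ := by linarith
  -- The angular integral lowers the exponent of the kernel by one; the remaining radial integral
  -- has kernel exponent `M - 1` and weight `(1 - r)^a`.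
  have hθint (d : ℝ) (hd : 0 < d) : ∫⁻ θ in Ioo (-Real.pi) Real.pi,
      ENNReal.ofReal ((d + |θ|) ^ (-M)) ≤ 2 * B * ENNReal.ofReal (d ^ (1 - M)) := by
    have h1 : ∫⁻ θ in Ioi (0 : ℝ), ENNReal.ofReal ((d + |θ|) ^ (-M)) ≤
        B * ENNReal.ofReal (d ^ (1 - M)) := by
      refine (setLIntegral_mono' measurableSet_Ioi fun v (hv : 0 < v) => ?_).trans (hint d hd)
      rw [abs_of_pos hv, sub_self, Real.rpow_zero, mul_one]
    have h2 : ∫⁻ θ in Iic (0 : ℝ), ENNReal.ofReal ((d + |θ|) ^ (-M)) =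
        ∫⁻ θ in Ioi (0 : ℝ), ENNReal.ofReal ((d + |θ|) ^ (-M)) := by
      rw [← lintegral_indicator measurableSet_Iic, ← lintegral_neg_eq_self,
        setLIntegral_congr Ioi_ae_eq_Ici, ← lintegral_indicator measurableSet_Ici]
      refine lintegral_congr fun x => ?_
      simp [indicator]
    calc _ ≤ ∫⁻ θ in Iic (0 : ℝ) ∪ Ioi 0, ENNReal.ofReal ((d + |θ|) ^ (-M)) :=
          lintegral_mono_set (by simp)
      _ ≤ _ := lintegral_union_le _ _ _
      _ ≤ _ := by
        rw [h2, ← two_mul, mul_assoc]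
        gcongr
  have hpt (r θ : ℝ) (hr : r ∈ Ioo (0 : ℝ) 1) (hθ : θ ∈ Ioo (-Real.pi) Real.pi) :
      ENNReal.ofReal r * ENNReal.ofReal
        (‖1 - t * (r * (Real.cos θ + Real.sin θ * Complex.I) : ℂ)‖ ^ (-M) *
          (1 - ‖(r * (Real.cos θ + Real.sin θ * Complex.I) : ℂ)‖ ^ 2) ^ a) ≤
      ENNReal.ofReal (20 ^ M * 3 ^ |a| * (1 - r) ^ a) *
        ENNReal.ofReal ((δ + (1 - r) + |θ|) ^ (-M)) := by
    obtain ⟨hr0, hr1⟩ := hr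
    rw [← ENNReal.ofReal_mul hr0.le, ← ENNReal.ofReal_mul (by
      have : 0 < 1 - r := by linarith
      positivity)]
    refine ENNReal.ofReal_le_ofReal ?_
    have hn : ‖(r * (Real.cos θ + Real.sin θ * Complex.I) : ℂ)‖ = r := by
      rw [← Complex.polarCoord_symm_apply (r, θ), Complex.norm_polarCoord_symm, abs_of_pos hr0]
    have hs : 0 < 1 - r := by linarith
    have ha := abs_nonneg θ
    have htr : t * r ≤ 1 := by nlinarith
    have hlow := norm_one_sub_mul_exp_ge (mul_nonneg ht0 hr0.le) htr
      (abs_le.2 ⟨hθ.1.le, hθ.2.le⟩)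
    rw [hn, ← mul_assoc (t : ℂ), ← Complex.ofReal_mul]
    -- `1 - t r` dominates both `1 - t` and `1 - r`, hence their mean; this turns the `10` of the
    -- lower bound into `20`.
    have h3 : (δ + (1 - r) + |θ|) / 20 ≤
        ‖1 - ((t * r : ℝ) : ℂ) * (Real.cos θ + Real.sin θ * Complex.I)‖ := by
      refine le_trans ?_ hlow
      nlinarith
    have h4 : ‖1 - ((t * r : ℝ) : ℂ) * (Real.cos θ + Real.sin θ * Complex.I)‖ ^ (-M) ≤
        20 ^ M * (δ + (1 - r) + |θ|) ^ (-M) := by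
      refine (Real.rpow_le_rpow_of_nonpos (by positivity) h3 (by linarith)).trans_eq ?_
      rw [Real.div_rpow (by positivity) (by norm_num), Real.rpow_neg (x := 20) (by norm_num),
        div_inv_eq_mul, mul_comm]
    have h5 : (1 - r ^ 2) ^ a ≤ 3 ^ |a| * (1 - r) ^ a :=
      rpow_le_three_rpow_mul a (by nlinarith) (by nlinarith) (by nlinarith)
    have h6 : 0 ≤ (1 - r ^ 2) ^ a := Real.rpow_nonneg (by nlinarith) _
    calc _ ≤ 1 * ((20 ^ M * (δ + (1 - r) + |θ|) ^ (-M)) * (3 ^ |a| * (1 - r) ^ a)) := by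
          gcongr
      _ = _ := by ring
  calc _ ≤ _ := lintegral_areaMeasure_le _
    _ = _ := setLIntegral_unitDisc_eq_polar
          (Measurable.indicator (by fun_prop) measurableSet_unitDisc)
    _ ≤ ∫⁻ r in Ioo (0 : ℝ) 1, ∫⁻ θ in Ioo (-Real.pi) Real.pi,
          ENNReal.ofReal (20 ^ M * 3 ^ |a| * (1 - r) ^ a) *
            ENNReal.ofReal ((δ + (1 - r) + |θ|) ^ (-M)) :=
        setLIntegral_mono' measurableSet_Ioo fun r hr =>
          setLIntegral_mono' measurableSet_Ioo fun θ hθ => hpt r θ hr hθ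
    _ ≤ ∫⁻ r in Ioo (0 : ℝ) 1, ENNReal.ofReal (20 ^ M * 3 ^ |a|) * (2 * B) *
          ENNReal.ofReal ((δ + (1 - r)) ^ (-(M - 1)) * (1 - r) ^ (a + 1 - 1)) := by
        refine setLIntegral_mono' measurableSet_Ioo fun r hr => ?_
        have hs : 0 < 1 - r := by linarith [hr.2]
        rw [lintegral_const_mul' _ _ ENNReal.ofReal_ne_top]
        refine (mul_le_mul' le_rfl (hθint _ (by linarith))).trans_eq ?_
        rw [ENNReal.ofReal_mul (p := 20 ^ M * 3 ^ |a|) (by positivity),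
          ENNReal.ofReal_mul (q := (1 - r) ^ (a + 1 - 1)) (by positivity),
          add_sub_cancel_right, neg_sub]
        ring
    _ = ENNReal.ofReal (20 ^ M * 3 ^ |a|) * (2 * B) * ∫⁻ r in Ioo (0 : ℝ) 1,
          ENNReal.ofReal ((δ + (1 - r)) ^ (-(M - 1)) * (1 - r) ^ (a + 1 - 1)) :=
        lintegral_const_mul' _ _ (by finiteness)
    _ ≤ ENNReal.ofReal (20 ^ M * 3 ^ |a|) * (2 * B) * ∫⁻ r in Ioi (0 : ℝ),
          ENNReal.ofReal ((δ + r) ^ (-(M - 1)) * r ^ (a + 1 - 1)) := by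
        refine mul_le_mul' le_rfl ?_
        rw [← lintegral_indicator measurableSet_Ioo, ← lintegral_indicator measurableSet_Ioi,
          ← lintegral_sub_left_eq_self _ (1 : ℝ)]
        refine lintegral_mono fun x => ?_
        by_cases hx : (1 : ℝ) - x ∈ Ioo (0 : ℝ) 1
        · rw [indicator_of_mem hx, indicator_of_mem (show x ∈ Ioi (0 : ℝ) by
            simp only [mem_Ioo, mem_Ioi] at hx ⊢; linarith), sub_sub_cancel]
        · rw [indicator_of_notMem hx]
          exact zero_le
    _ ≤ _ := by
        rw [mul_assoc _ B']
        refine mul_le_mul' le_rfl ((hint' δ hδ0).trans_eq ?_)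
        congr 3; ring

/-! ### Local mean value estimates and dyadic sampling -/

/-- A local mean value estimate for `‖h‖ ^ p`, valid for every `p > 0`. -/
theorem norm_rpow_mul_sq_le {p : ℝ} (hp : 0 < p) :
    ∃ C : ℝ≥0∞, C ≠ ∞ ∧ ∀ (h : ℂ → ℂ) (c : ℂ) (r : ℝ), 0 < r →
      DifferentiableOn ℂ h (Metric.ball c r) →
      ENNReal.ofReal (‖h c‖ ^ p * r ^ 2) ≤
        C * ∫⁻ z in Metric.ball c r, ENNReal.ofReal (‖h z‖ ^ p) := by
  set K : ℝ := 2 ^ (2 / p) with hK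
  have hK0 : 0 < K := by positivity
  refine ⟨ENNReal.ofReal (64 * 2 ^ p * (K + 2) ^ 2), by finiteness, fun h c r hr hd => ?_⟩
  rcases eq_or_ne (h c) 0 with h0 | h0
  · simp [h0, Real.zero_rpow hp.ne']
  have hc0 : 0 < ‖h c‖ := norm_pos_iff.2 h0
  set R := r / 2 with hR
  have hR0 : 0 < R := by positivity
  have hsub : Metric.closedBall c R ⊆ Metric.ball c r :=
    Metric.closedBall_subset_ball (by linarith)
  have hcont : ContinuousOn (fun z => (R - dist z c) ^ (2 / p) * ‖h z‖) (Metric.closedBall c R) := by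
    refine ContinuousOn.mul (ContinuousOn.rpow_const (by fun_prop) fun _ _ => Or.inr ?_)
      (hd.continuousOn.mono hsub).norm
    positivity
  -- Subharmonicity is replaced by a maximal point. The exponent `2/p` makes the `p`-th power of the
  -- weight a squared distance, so maximality gives `R² |h(c)|^p ≤ (R - |w - c|)² |h(w)|^p`, and it
  -- suffices to bound the integral below near `w`.
  obtain ⟨w, hw, hmax⟩ := (isCompact_closedBall c R).exists_isMaxOn
    ⟨c, Metric.mem_closedBall_self hR0.le⟩ hcont
  have hmax' : ∀ z ∈ Metric.closedBall c R,
      (R - dist z c) ^ (2 / p) * ‖h z‖ ≤ (R - dist w c) ^ (2 / p) * ‖h w‖ := fun z hz => hmax hz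
  have hmaxc := hmax' c (Metric.mem_closedBall_self hR0.le)
  rw [dist_self, sub_zero] at hmaxc
  have hwR : 0 ≤ R - dist w c := sub_nonneg.2 hw
  have hpos : 0 < (R - dist w c) ^ (2 / p) * ‖h w‖ := lt_of_lt_of_le (by positivity) hmaxc
  have hw0 : 0 < ‖h w‖ := by
    by_contra hcon
    rw [le_antisymm (not_lt.1 hcon) (norm_nonneg _), mul_zero] at hpos
    exact lt_irrefl _ hpos
  have hwR0 : 0 < R - dist w c := by
    refine hwR.lt_of_ne fun hcon => ?_
    rw [← hcon, Real.zero_rpow (by positivity), zero_mul] at hpos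
    exact lt_irrefl _ hpos
  set d := (R - dist w c) / 2 with hd'
  have hd0 : 0 < d := by positivity
  have h2d : R - dist w c = 2 * d := by rw [hd']; ring
  have hball : Metric.ball w d ⊆ Metric.closedBall c R := fun z hz => by
    have := dist_triangle z w c
    simp only [Metric.mem_ball, Metric.mem_closedBall] at hz ⊢
    linarith
  -- Within half the distance from `w` to the boundary, the weight drops by a factor of at most
  -- `2^(2/p) = K`, so maximality controls `h` by `K |h(w)|`.
  have hbound : ∀ z ∈ Metric.ball w d, ‖h z‖ ≤ K * ‖h w‖ := fun z hz => by
    have h1 := hmax' z (hball hz)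
    have h2 : d ≤ R - dist z c := by
      have := dist_triangle z w c
      simp only [Metric.mem_ball] at hz
      linarith
    have h3 : d ^ (2 / p) * ‖h z‖ ≤ d ^ (2 / p) * (K * ‖h w‖) := by
      refine le_trans ?_ (h1.trans_eq ?_)
      · gcongr
      · rw [h2d, Real.mul_rpow zero_le_two hd0.le]; ring
    exact le_of_mul_le_mul_left h3 (by positivity)
  have hmaps : MapsTo h (Metric.ball w d) (Metric.closedBall (h w) ((K + 2) * ‖h w‖)) :=
    fun z hz => by
      rw [mem_closedBall_iff_norm]
      have := norm_sub_le (h z) (h w)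
      have := hbound z hz
      nlinarith
  have hdw : DifferentiableOn ℂ h (Metric.ball w d) := hd.mono (hball.trans hsub)
  -- The radius at which the Schwarz lemma bounds the oscillation of `h` about `h(w)` by `|h(w)|/2`.
  set ε := d / (2 * (K + 2)) with hε
  have hε0 : 0 < ε := by positivity
  have hεd : ε ≤ d := div_le_self hd0.le (by linarith)
  have hlow : ∀ z ∈ Metric.ball w ε, (‖h w‖ / 2) ^ p ≤ ‖h z‖ ^ p := fun z hz => by
    have h1 := Complex.dist_le_div_mul_dist_of_mapsTo_ball hdw hmaps
      (Metric.ball_subset_ball hεd hz)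
    have h2 : (K + 2) * ‖h w‖ / d * dist z w ≤ (K + 2) * ‖h w‖ / d * ε := by
      have := (Metric.mem_ball.1 hz).le
      gcongr
    have h3 : (K + 2) * ‖h w‖ / d * ε = ‖h w‖ / 2 := by
      rw [hε]; field_simp
    rw [dist_eq_norm] at h1
    have h4 := norm_sub_norm_le (h w) (h z)
    rw [norm_sub_rev] at h4
    exact Real.rpow_le_rpow (by positivity) (by linarith) hp.le
  have hint : ENNReal.ofReal ((‖h w‖ / 2) ^ p * ε ^ 2) ≤
      ∫⁻ z in Metric.ball c r, ENNReal.ofReal (‖h z‖ ^ p) := by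
    calc ENNReal.ofReal ((‖h w‖ / 2) ^ p * ε ^ 2)
        ≤ ENNReal.ofReal ((‖h w‖ / 2) ^ p) * volume (Metric.ball w ε) := by
          rw [ENNReal.ofReal_mul (by positivity), Complex.volume_ball, ← ENNReal.ofReal_pow hε0.le]
          refine mul_le_mul' le_rfl (le_mul_of_one_le_right' ?_)
          rw [← ENNReal.coe_one, ENNReal.coe_le_coe, ← NNReal.coe_le_coe]
          simp only [NNReal.coe_one, NNReal.coe_real_pi]
          linarith [Real.pi_gt_three]
      _ = ∫⁻ _ in Metric.ball w ε, ENNReal.ofReal ((‖h w‖ / 2) ^ p) := (setLIntegral_const _ _).symm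
      _ ≤ ∫⁻ z in Metric.ball w ε, ENNReal.ofReal (‖h z‖ ^ p) :=
          setLIntegral_mono' measurableSet_ball fun z hz => ENNReal.ofReal_le_ofReal (hlow z hz)
      _ ≤ _ := lintegral_mono_set ((Metric.ball_subset_ball hεd).trans (hball.trans hsub))
  refine le_trans ?_ (mul_le_mul' le_rfl hint)
  rw [← ENNReal.ofReal_mul (by positivity)]
  refine ENNReal.ofReal_le_ofReal ?_
  have hpow (x y : ℝ) (hx : 0 ≤ x) (hy : 0 ≤ y) : (x ^ (2 / p) * y) ^ p = x ^ 2 * y ^ p := by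
    rw [Real.mul_rpow (by positivity) hy, ← Real.rpow_mul hx, div_mul_cancel₀ _ hp.ne']
    norm_num
  have h5 := Real.rpow_le_rpow (by positivity) hmaxc hp.le
  rw [hpow _ _ hR0.le hc0.le, hpow _ _ hwR hw0.le, h2d] at h5
  calc ‖h c‖ ^ p * r ^ 2 = 4 * (R ^ 2 * ‖h c‖ ^ p) := by rw [hR]; ring
    _ ≤ 4 * ((2 * d) ^ 2 * ‖h w‖ ^ p) := by gcongr
    _ = _ := by
      rw [hε, Real.div_rpow hw0.le zero_le_two]
      field_simp
      ring

theorem aemeasurable_weighted {h : ℂ → ℂ} (hd : DifferentiableOn ℂ h unitDisc) (p a : ℝ) :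
    AEMeasurable (fun z => ENNReal.ofReal (‖h z‖ ^ p * (1 - ‖z‖ ^ 2) ^ a)) areaMeasure := by
  have hh : AEMeasurable h areaMeasure :=
    (hd.continuousOn.aemeasurable measurableSet_unitDisc).smul_measure _
  refine ENNReal.measurable_ofReal.comp_aemeasurable ?_
  refine AEMeasurable.mul (hh.norm.pow_const _) ?_
  exact Measurable.aemeasurable (by fun_prop)

/-- Weighted pointwise estimate for analytic functions in the disc. -/
theorem norm_rpow_mul_one_sub_rpow_le {p : ℝ} (hp : 0 < p) (α : ℝ) :
    ∃ C : ℝ≥0∞, C ≠ ∞ ∧ ∀ h : ℂ → ℂ, DifferentiableOn ℂ h unitDisc → ∀ z ∈ unitDisc,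
      ENNReal.ofReal (‖h z‖ ^ p * (1 - ‖z‖) ^ (α + 2)) ≤
        C * ∫⁻ w in Metric.ball z ((1 - ‖z‖) / 2),
          ENNReal.ofReal (‖h w‖ ^ p * (1 - ‖w‖ ^ 2) ^ α) ∂areaMeasure := by
  obtain ⟨C, hC, hmain⟩ := norm_rpow_mul_sq_le hp
  refine ⟨ENNReal.ofReal (4 * 3 ^ |α|) * (C * ENNReal.ofReal Real.pi), by finiteness,
    fun h hd z hz => ?_⟩
  have hz1 := mem_unitDisc.1 hz
  set x := 1 - ‖z‖ with hx
  have hx0 : 0 < x := by linarith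
  have hnorm : ∀ w ∈ Metric.ball z (x / 2), x / 2 ≤ 1 - ‖w‖ ∧ 1 - ‖w‖ ≤ 3 / 2 * x := fun w hw => by
    rw [mem_ball_iff_norm] at hw
    have h1 := norm_sub_norm_le w z
    have h2 := norm_sub_norm_le z w
    rw [norm_sub_rev] at h2
    constructor <;> linarith
  have hsub : Metric.ball z (x / 2) ⊆ unitDisc := fun w hw => by
    rw [mem_unitDisc]
    linarith [(hnorm w hw).1]
  calc ENNReal.ofReal (‖h z‖ ^ p * x ^ (α + 2))
      = ENNReal.ofReal (4 * x ^ α) * ENNReal.ofReal (‖h z‖ ^ p * (x / 2) ^ 2) := by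
        rw [← ENNReal.ofReal_mul (by positivity), Real.rpow_add hx0, Real.rpow_two]
        congr 1; ring
    _ ≤ ENNReal.ofReal (4 * x ^ α) *
          (C * ∫⁻ w in Metric.ball z (x / 2), ENNReal.ofReal (‖h w‖ ^ p)) := by
        gcongr
        exact hmain h z (x / 2) (by positivity) (hd.mono hsub)
    _ = C * ∫⁻ w in Metric.ball z (x / 2),
          ENNReal.ofReal (4 * x ^ α) * ENNReal.ofReal (‖h w‖ ^ p) := by
        rw [lintegral_const_mul' _ _ ENNReal.ofReal_ne_top, mul_left_comm]
    _ ≤ C * ∫⁻ w in Metric.ball z (x / 2), ENNReal.ofReal (4 * 3 ^ |α|) *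
          ENNReal.ofReal (‖h w‖ ^ p * (1 - ‖w‖ ^ 2) ^ α) := by
        refine mul_le_mul' le_rfl (setLIntegral_mono' measurableSet_ball fun w hw => ?_)
        rw [← ENNReal.ofReal_mul (by positivity), ← ENNReal.ofReal_mul (by positivity)]
        refine ENNReal.ofReal_le_ofReal ?_
        obtain ⟨h1, h2⟩ := hnorm w hw
        have hw0 := norm_nonneg w
        have h3 : x ^ α ≤ 3 ^ |α| * (1 - ‖w‖ ^ 2) ^ α :=
          rpow_le_three_rpow_mul α hx0 (by nlinarith) (by nlinarith)
        calc 4 * x ^ α * ‖h w‖ ^ p ≤ 4 * (3 ^ |α| * (1 - ‖w‖ ^ 2) ^ α) * ‖h w‖ ^ p := by gcongr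
          _ = _ := by ring
    _ = ENNReal.ofReal (4 * 3 ^ |α|) * (C * ∫⁻ w in Metric.ball z (x / 2),
          ENNReal.ofReal (‖h w‖ ^ p * (1 - ‖w‖ ^ 2) ^ α)) := by
        rw [lintegral_const_mul' _ _ ENNReal.ofReal_ne_top, mul_left_comm]
    _ ≤ _ := by
        rw [mul_assoc, mul_assoc]
        gcongr
        exact setLIntegral_le_areaMeasure hsub _

/-- If `i` is the first annulus containing `w`, then `1 - |w| ≥ 2^(-i)/4`, whereas membership for `j
≥ i + 4` would force `1 - |w| ≤ 2^(-i)/8`. So at most four annuli meet at `w`. -/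
theorem sum_indicator_annulus_le (N : ℕ) (w : ℂ) (G : ℝ≥0∞) :
    ∑ j ∈ Finset.range N, {w : ℂ | (1 / 2 : ℝ) ^ j / 4 ≤ 1 - ‖w‖ ∧
      1 - ‖w‖ ≤ 2 * (1 / 2 : ℝ) ^ j}.indicator (fun _ => G) w ≤ 4 * G := by
  by_cases hex : ∃ j : ℕ, (1 / 2 : ℝ) ^ j / 4 ≤ 1 - ‖w‖ ∧ 1 - ‖w‖ ≤ 2 * (1 / 2 : ℝ) ^ j
  · classical
    set i := Nat.find hex with hi
    have hspec := Nat.find_spec hex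
    rw [← hi] at hspec
    calc _ ≤ ∑ j ∈ Finset.Ico i (i + 4), G := by
          rw [← Finset.sum_filter_add_sum_filter_not (Finset.range N)
            (fun j => j ∈ Finset.Ico i (i + 4))]
          rw [Finset.sum_eq_zero (s := (Finset.range N).filter fun j => ¬ j ∈ Finset.Ico i (i + 4)),
            add_zero]
          · calc _ ≤ ∑ j ∈ (Finset.range N).filter (fun j => j ∈ Finset.Ico i (i + 4)), G :=
                Finset.sum_le_sum fun j _ => indicator_le_self' (fun _ _ => zero_le) w
              _ ≤ _ := Finset.sum_le_sum_of_subset fun j hj => (Finset.mem_filter.1 hj).2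
          · intro j hj
            rw [indicator_of_notMem]
            refine fun hmem => (Finset.mem_filter.1 hj).2 ?_
            rw [Finset.mem_Ico]
            refine ⟨Nat.find_min' hex hmem, ?_⟩
            by_contra hcon
            have h1 : (1 / 2 : ℝ) ^ j ≤ (1 / 2) ^ (i + 4) :=
              pow_le_pow_of_le_one (by norm_num) (by norm_num) (not_lt.1 hcon)
            rw [pow_add] at h1
            have h2 : (0 : ℝ) < (1 / 2) ^ i := by positivity
            have h3 : 1 - ‖w‖ ≤ 2 * (1 / 2 : ℝ) ^ j := hmem.2
            have h4 := hspec.1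
            norm_num only at h1
            linarith
      _ = 4 * G := by simp
  · refine (Finset.sum_eq_zero fun j _ => ?_).trans_le zero_le
    rw [indicator_of_notMem]
    exact fun h => hex ⟨j, h⟩

/-- Sampling along a dyadic sequence of radii. -/
theorem sum_norm_rpow_dyadic_le {p α : ℝ} (hp : 0 < p) (hα : -2 ≤ α) :
    ∃ C : ℝ≥0∞, C ≠ ∞ ∧ ∀ h : ℂ → ℂ, DifferentiableOn ℂ h unitDisc → ∀ x : ℕ → ℝ,
      (∀ j, 1 - (1 / 2 : ℝ) ^ j ≤ x j ∧ x j ≤ 1 - (1 / 2 : ℝ) ^ (j + 1)) → ∀ N : ℕ,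
      ∑ j ∈ Finset.range N, ENNReal.ofReal (‖h (x j)‖ ^ p * ((1 / 2 : ℝ) ^ j) ^ (α + 2)) ≤
        C * ∫⁻ w, ENNReal.ofReal (‖h w‖ ^ p * (1 - ‖w‖ ^ 2) ^ α) ∂areaMeasure := by
  obtain ⟨C, hC, hmain⟩ := norm_rpow_mul_one_sub_rpow_le hp α
  refine ⟨ENNReal.ofReal (2 ^ (α + 2)) * C * 4, by finiteness, fun h hd x hx N => ?_⟩
  set G : ℂ → ℝ≥0∞ := fun w => ENNReal.ofReal (‖h w‖ ^ p * (1 - ‖w‖ ^ 2) ^ α) with hG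
  set E : ℕ → Set ℂ := fun j => {w : ℂ | (1 / 2 : ℝ) ^ j / 4 ≤ 1 - ‖w‖ ∧
      1 - ‖w‖ ≤ 2 * (1 / 2 : ℝ) ^ j} with hE
  have hEm (j : ℕ) : MeasurableSet (E j) := by
    change MeasurableSet ({w : ℂ | (1 / 2 : ℝ) ^ j / 4 ≤ 1 - ‖w‖} ∩
      {w : ℂ | 1 - ‖w‖ ≤ 2 * (1 / 2 : ℝ) ^ j})
    exact (measurableSet_le (by fun_prop) (by fun_prop)).inter
      (measurableSet_le (by fun_prop) (by fun_prop))
  have hterm (j : ℕ) : ENNReal.ofReal (‖h (x j)‖ ^ p * ((1 / 2 : ℝ) ^ j) ^ (α + 2)) ≤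
      ENNReal.ofReal (2 ^ (α + 2)) * C * ∫⁻ w, (E j).indicator G w ∂areaMeasure := by
    obtain ⟨h1, h2⟩ := hx j
    have hu : (0 : ℝ) < (1 / 2) ^ j := by positivity
    have hu1 : (1 / 2 : ℝ) ^ j ≤ 1 := pow_le_one₀ (by norm_num) (by norm_num)
    rw [pow_succ] at h2
    have hx0 : 0 ≤ x j := by linarith
    have hxn : ‖(x j : ℂ)‖ = x j := by rw [Complex.norm_real, Real.norm_of_nonneg hx0]
    have hxD : (x j : ℂ) ∈ unitDisc := by rw [mem_unitDisc, hxn]; linarith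
    -- `1 - x j` lies between `2^(-j)/2` and `2^(-j)`; moving by half of it keeps `1 - |w|` between
    -- `2^(-j)/4` and `2 · 2^(-j)`. This fixes the constants in `E`.
    have hball : Metric.ball (x j : ℂ) ((1 - x j) / 2) ⊆ E j := fun w hw => by
      rw [mem_ball_iff_norm] at hw
      have h3 := norm_sub_norm_le w (x j)
      have h4 := norm_sub_norm_le (x j : ℂ) w
      rw [norm_sub_rev] at h4
      rw [hxn] at h3 h4
      constructor <;> linarith
    rw [lintegral_indicator (hEm j), mul_assoc]
    calc _ ≤ ENNReal.ofReal (2 ^ (α + 2)) *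
          ENNReal.ofReal (‖h (x j)‖ ^ p * (1 - ‖(x j : ℂ)‖) ^ (α + 2)) := by
          rw [← ENNReal.ofReal_mul (by positivity)]
          refine ENNReal.ofReal_le_ofReal ?_
          rw [hxn, mul_left_comm, ← Real.mul_rpow zero_le_two (by linarith)]
          refine mul_le_mul_of_nonneg_left ?_ (by positivity)
          exact Real.rpow_le_rpow hu.le (by linarith) (by linarith)
      _ ≤ ENNReal.ofReal (2 ^ (α + 2)) *
          (C * ∫⁻ w in Metric.ball (x j : ℂ) ((1 - x j) / 2), G w ∂areaMeasure) := by
          have := hmain h hd _ hxD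
          rw [hxn] at this ⊢
          gcongr
      _ ≤ _ := by
          gcongr
  calc _ ≤ ∑ j ∈ Finset.range N,
        ENNReal.ofReal (2 ^ (α + 2)) * C * ∫⁻ w, (E j).indicator G w ∂areaMeasure :=
        Finset.sum_le_sum fun j _ => hterm j
    _ = ENNReal.ofReal (2 ^ (α + 2)) * C *
          ∫⁻ w, ∑ j ∈ Finset.range N, (E j).indicator G w ∂areaMeasure := by
        rw [← Finset.mul_sum, lintegral_finsetSum' _ fun j _ =>
          (aemeasurable_weighted hd p α).indicator (hEm j)]
    _ ≤ ENNReal.ofReal (2 ^ (α + 2)) * C * ∫⁻ w, 4 * G w ∂areaMeasure := by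
        gcongr with w
        exact sum_indicator_annulus_le N w (G w)
    _ = _ := by
        rw [lintegral_const_mul' _ _ (by norm_num)]
        ring

/-! ### Discrete Hardy inequality and Carleson embedding -/

/-- A discrete Hardy inequality with geometric weights. -/
theorem sum_geometric_mul_rpow_le {p l : ℝ} (hp : 0 < p) (hl0 : 0 < l) (hl1 : l < 1) :
    ∃ C : ℝ, 0 < C ∧ ∀ A B : ℕ → ℝ, (∀ j, 0 ≤ A j) → (∀ j, 0 ≤ B j) →
      (∀ j, A (j + 1) ≤ A j + B j) → ∀ N : ℕ,
      ∑ j ∈ Finset.range N, l ^ j * A j ^ p ≤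
        C * (A 0 ^ p + ∑ j ∈ Finset.range N, l ^ j * B j ^ p) := by
  -- Chosen so that `l ρ^p = l^(1/2) < 1`: half of the geometric decay pays for the loss in `key`.
  set ρ : ℝ := l ^ (-(1 / (2 * p))) with hρ
  have hρ1 : 1 < ρ := Real.one_lt_rpow_of_pos_of_lt_one_of_neg hl0 hl1 (by
    have : 0 < 1 / (2 * p) := by positivity
    linarith)
  set η := ρ - 1 with hη
  have hη0 : 0 < η := by linarith
  set K : ℝ := (1 / η + 1) ^ p with hKdef
  have hK0 : 0 < K := by positivity
  set σ : ℝ := l ^ (1 / 2 : ℝ) with hσ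
  have hσ1 : σ < 1 := Real.rpow_lt_one hl0.le hl1 (by norm_num)
  have hσρ : l * ρ ^ p = σ := by
    rw [hρ, hσ, ← Real.rpow_mul hl0.le, ← Real.rpow_one_add' hl0.le]
    · congr 1; field_simp; norm_num
    · field_simp; norm_num
  -- A substitute for convexity valid for all `p > 0`: either `b ≤ η a`, and `a + b ≤ ρ a`, or `a`
  -- is dominated by `b / η`.
  have key (a b : ℝ) (ha : 0 ≤ a) (hb : 0 ≤ b) : (a + b) ^ p ≤ ρ ^ p * a ^ p + K * b ^ p := by
    rcases le_total b (η * a) with h | h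
    · have : (a + b) ^ p ≤ ρ ^ p * a ^ p := by
        rw [← Real.mul_rpow (by positivity) ha]
        refine Real.rpow_le_rpow (by positivity) ?_ hp.le
        rw [show ρ = η + 1 by ring]; linarith
      have : 0 ≤ K * b ^ p := by positivity
      linarith
    · have : (a + b) ^ p ≤ K * b ^ p := by
        rw [hKdef, ← Real.mul_rpow (by positivity) hb]
        refine Real.rpow_le_rpow (by positivity) ?_ hp.le
        have : a ≤ 1 / η * b := by
          rw [div_mul_eq_mul_div, one_mul, le_div_iff₀ hη0]; linarith
        linarith
      have : 0 ≤ ρ ^ p * a ^ p := by positivity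
      linarith
  refine ⟨(1 + K) / (1 - σ), div_pos (by linarith) (by linarith), fun A B hA hB hAB N => ?_⟩
  set S := ∑ j ∈ Finset.range N, l ^ j * A j ^ p with hS
  set T := ∑ j ∈ Finset.range N, l ^ j * B j ^ p with hT
  have hT0 : 0 ≤ T := Finset.sum_nonneg fun j _ => by have := hB j; positivity
  have hA0 : 0 ≤ A 0 ^ p := Real.rpow_nonneg (hA 0) _
  have h1 : S ≤ ∑ j ∈ Finset.range (N + 1), l ^ j * A j ^ p := by
    rw [Finset.sum_range_succ]
    have := hA N
    have : 0 ≤ l ^ N * A N ^ p := by positivity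
    linarith
  -- Shifting the index and applying `key` reproduces `S` with factor `σ < 1`, which is then
  -- absorbed on the left.
  have h2 : ∑ j ∈ Finset.range (N + 1), l ^ j * A j ^ p ≤ A 0 ^ p + (σ * S + l * K * T) := by
    rw [Finset.sum_range_succ', pow_zero, one_mul, add_comm, hS, hT, Finset.mul_sum, Finset.mul_sum,
      ← Finset.sum_add_distrib]
    gcongr with j _
    calc l ^ (j + 1) * A (j + 1) ^ p ≤ l ^ (j + 1) * (ρ ^ p * A j ^ p + K * B j ^ p) := by
          gcongr
          exact (Real.rpow_le_rpow (hA _) (hAB j) hp.le).trans (key _ _ (hA j) (hB j))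
      _ = _ := by rw [← hσρ]; ring
  have h3 : l * K * T ≤ K * T := by
    have : 0 ≤ K * T := by positivity
    nlinarith
  rw [div_mul_eq_mul_div, le_div_iff₀ (by linarith)]
  nlinarith [mul_nonneg hK0.le hA0]

theorem bergmanNorm_rpow {p : ℝ} (hp : 0 < p) (α : ℝ) (h : ℂ → ℂ) :
    bergmanNorm p α h ^ p = ENNReal.ofReal (α + 1) *
      ∫⁻ z, ENNReal.ofReal (‖h z‖ ^ p * (1 - ‖z‖ ^ 2) ^ α) ∂areaMeasure := by
  rw [bergmanNorm, ← ENNReal.rpow_mul, one_div, inv_mul_cancel₀ hp.ne', ENNReal.rpow_one]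

theorem lintegral_deriv_le_dirichletNorm_rpow {p α : ℝ} (hp : 0 < p) (hα : -1 < α) (f : ℂ → ℂ) :
    ∫⁻ z, ENNReal.ofReal (‖deriv f z‖ ^ p * (1 - ‖z‖ ^ 2) ^ α) ∂areaMeasure ≤
      ENNReal.ofReal (1 / (α + 1)) * dirichletNorm p α f ^ p := by
  have hα' : 0 < α + 1 := by linarith
  calc _ = ENNReal.ofReal (1 / (α + 1)) * bergmanNorm p α (deriv f) ^ p := by
        rw [bergmanNorm_rpow hp, ← mul_assoc, ← ENNReal.ofReal_mul (by positivity),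
          one_div_mul_cancel hα'.ne', ENNReal.ofReal_one, one_mul]
    _ ≤ _ := by
        gcongr
        exact le_add_self

theorem differentiableOn_deriv {f : ℂ → ℂ} (hf : DifferentiableOn ℂ f unitDisc) :
    DifferentiableOn ℂ (deriv f) unitDisc :=
  hf.deriv isOpen_unitDisc

theorem ofReal_mem_unitDisc {x : ℝ} (h0 : 0 ≤ x) (h1 : x < 1) : (x : ℂ) ∈ unitDisc := by
  rwa [mem_unitDisc, Complex.norm_real, Real.norm_of_nonneg h0]

theorem continuous_comp_coe {f : ℂ → ℂ} (hf : DifferentiableOn ℂ f unitDisc) :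
    Continuous fun t : Ico (0 : ℝ) 1 => f ((t : ℝ) : ℂ) :=
  hf.continuousOn.comp_continuous (by fun_prop) fun t => ofReal_mem_unitDisc t.2.1 t.2.2

/-- Dyadic majorants for an analytic function on the radius `[0, 1)`. -/
theorem exists_dyadic_majorant {f : ℂ → ℂ} (hf : DifferentiableOn ℂ f unitDisc) :
    ∃ x : ℕ → ℝ, (∀ j, 1 - (1 / 2 : ℝ) ^ j ≤ x j ∧ x j ≤ 1 - (1 / 2 : ℝ) ^ (j + 1)) ∧
      ∀ j (t : ℝ), 0 ≤ t → (1 / 2 : ℝ) ^ j ≤ 1 - t →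
        ‖f t‖ ≤ ‖f 0‖ + ∑ i ∈ Finset.range j, ‖deriv f (x i)‖ * (1 / 2 : ℝ) ^ i := by
  have hpow (j : ℕ) : (0 : ℝ) < (1 / 2) ^ j := by positivity
  have hpow1 (j : ℕ) : (1 / 2 : ℝ) ^ j ≤ 1 := pow_le_one₀ (by norm_num) (by norm_num)
  -- `x j` maximizes `|f'|` on the `j`-th dyadic interval, so the mean value inequality bounds the
  -- increment of `f` there by `|f'(x j)| 2^(-j)`.
  have hex (j : ℕ) : ∃ x ∈ Icc (1 - (1 / 2 : ℝ) ^ j) (1 - (1 / 2 : ℝ) ^ (j + 1)),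
      IsMaxOn (fun x : ℝ => ‖deriv f x‖) (Icc (1 - (1 / 2 : ℝ) ^ j) (1 - (1 / 2 : ℝ) ^ (j + 1))) x := by
    refine isCompact_Icc.exists_isMaxOn (nonempty_Icc.2 ?_) ?_
    · have := hpow j
      rw [pow_succ]; linarith
    · refine (((differentiableOn_deriv hf).continuousOn).comp (by fun_prop) fun x hx => ?_).norm
      have := hpow (j + 1)
      have := hpow1 j
      exact ofReal_mem_unitDisc (by linarith [hx.1]) (by linarith [hx.2])
  choose x hx hmax using hex
  refine ⟨x, hx, fun j => ?_⟩
  induction j with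
  | zero =>
    intro t ht0 ht
    have : t = 0 := by rw [pow_zero] at ht; linarith
    simp [this]
  | succ j ih =>
    intro t ht0 ht
    rw [Finset.sum_range_succ, ← add_assoc]
    have hm0 : 0 ≤ ‖deriv f (x j)‖ * (1 / 2 : ℝ) ^ j := by positivity
    rcases le_or_gt ((1 / 2 : ℝ) ^ j) (1 - t) with h | h
    · linarith [ih t ht0 h]
    · have h1 := ih (1 - (1 / 2) ^ j) (by linarith [hpow1 j]) (by linarith)
      have h2 : ‖f t - f ((1 - (1 / 2) ^ j : ℝ) : ℂ)‖ ≤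
          ‖deriv f (x j)‖ * (t - (1 - (1 / 2) ^ j)) := by
        refine norm_image_sub_le_of_norm_deriv_le_segment' (f := fun x : ℝ => f x)
          (f' := fun x : ℝ => deriv f x) (a := 1 - (1 / 2) ^ j) (b := t) (fun y hy => ?_)
          (fun y hy => ?_) t ⟨by linarith, le_rfl⟩
        · have hyD : (y : ℂ) ∈ unitDisc := ofReal_mem_unitDisc
            (by linarith [hy.1, hpow1 j]) (by linarith [hy.2, hpow (j + 1)])
          exact ((hf.differentiableAt
            (isOpen_unitDisc.mem_nhds hyD)).hasDerivAt.comp_ofReal).hasDerivWithinAt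
        · exact hmax j ⟨hy.1, by linarith [hy.2]⟩
      have h3 : ‖deriv f (x j)‖ * (t - (1 - (1 / 2) ^ j)) ≤ ‖deriv f (x j)‖ * (1 / 2 : ℝ) ^ j := by
        gcongr
        have := hpow (j + 1)
        linarith
      have h4 := norm_sub_norm_le (f t) (f ((1 - (1 / 2) ^ j : ℝ) : ℂ))
      linarith

/-- Write `x_j^r = x_j^(r-1) x_j` and bound the first factor by the same power of the whole sum.
This passes from exponent `p` to `P ≥ p` in the embedding. -/
theorem tsum_rpow_le_rpow_tsum {r : ℝ} (hr : 1 ≤ r) (x : ℕ → ℝ≥0∞) :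
    ∑' j, x j ^ r ≤ (∑' j, x j) ^ r := by
  have h (a : ℝ≥0∞) : a ^ r = a ^ (r - 1) * a := by
    conv_lhs => rw [← sub_add_cancel r 1]
    rw [ENNReal.rpow_add_of_nonneg _ _ (by linarith) zero_le_one, ENNReal.rpow_one]
  calc ∑' j, x j ^ r ≤ ∑' j, (∑' i, x i) ^ (r - 1) * x j := by
        refine ENNReal.tsum_le_tsum fun j => ?_
        rw [h]
        exact mul_le_mul' (ENNReal.rpow_le_rpow (ENNReal.le_tsum j) (by linarith)) le_rfl
    _ = _ := by rw [ENNReal.tsum_mul_left, ← h]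

/-- Carleson embedding for the spaces of Dirichlet type, for measures on the radius. -/
theorem lintegral_norm_rpow_le_dirichletNorm {p α P : ℝ} (hp : 0 < p) (hα : p - 1 < α)
    (hP : p ≤ P) {μ : Measure (Ico (0 : ℝ) 1)} (hμ : IsCarleson (P * ((α + 2 - p) / p)) μ) :
    ∃ C : ℝ≥0∞, C ≠ ∞ ∧ ∀ f : ℂ → ℂ, DifferentiableOn ℂ f unitDisc →
      ∫⁻ t : Ico (0 : ℝ) 1, ENNReal.ofReal (‖f ((t : ℝ) : ℂ)‖ ^ P) ∂μ ≤
        C * dirichletNorm p α f ^ P := by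
  have hP0 : 0 < P := hp.trans_le hP
  have hx0 : 0 < α + 2 - p := by linarith
  obtain ⟨Cμ, hCμ, hμ'⟩ := hμ.measure_le (by positivity)
  -- With this ratio, `l^j B_j^p = |f'(x_j)|^p 2^(-j(α+2))`, precisely the sampled quantity; `l < 1`
  -- because `α + 2 > p`.
  set l : ℝ := (1 / 2) ^ (α + 2 - p) with hl
  have hl0 : 0 < l := by positivity
  obtain ⟨CH, hCH, hHardy⟩ := sum_geometric_mul_rpow_le hp hl0
    (Real.rpow_lt_one (by norm_num) (by norm_num) hx0)
  obtain ⟨CS, hCS, hsample⟩ := sum_norm_rpow_dyadic_le (α := α) hp (by linarith)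
  set D : ℝ≥0∞ := ENNReal.ofReal (l⁻¹ * CH) *
    (1 + CS * ENNReal.ofReal (1 / (α + 1))) with hD
  have hDfin : D ≠ ∞ := by finiteness
  refine ⟨ENNReal.ofReal Cμ * D ^ (P / p), ?_, fun f hf => ?_⟩
  · exact ENNReal.mul_ne_top ENNReal.ofReal_ne_top
      (ENNReal.rpow_ne_top_of_nonneg (by positivity) hDfin)
  obtain ⟨x, hx, hmaj⟩ := exists_dyadic_majorant hf
  set B : ℕ → ℝ := fun j => ‖deriv f (x j)‖ * (1 / 2 : ℝ) ^ j with hB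
  set A : ℕ → ℝ := fun j => ‖f 0‖ + ∑ i ∈ Finset.range j, B i with hA
  have hB0 (j : ℕ) : 0 ≤ B j := by positivity
  have hA0 (j : ℕ) : 0 ≤ A j := add_nonneg (norm_nonneg _) (Finset.sum_nonneg fun i _ => hB0 i)
  have hu (j : ℕ) : (0 : ℝ) < (1 / 2) ^ j := by positivity
  have hlpow (j : ℕ) : l ^ j = ((1 / 2 : ℝ) ^ j) ^ (α + 2 - p) := by
    rw [hl, ← Real.rpow_natCast, ← Real.rpow_natCast, ← Real.rpow_mul (by norm_num),
      ← Real.rpow_mul (by norm_num), mul_comm]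
  -- The majorant carries index `j + 1` because `1 - t` exceeds only `2^(-(j+1))` on the piece `I j`
  -- below; the shift costs the factor `l⁻¹`.
  have hsum : ∑' j, ENNReal.ofReal (l ^ j * A (j + 1) ^ p) ≤ D * dirichletNorm p α f ^ p := by
    refine ENNReal.tsum_le_of_sum_range_le fun N => ?_
    have h1 := hHardy A B hA0 hB0 (fun j => by
      simp only [hA, Finset.sum_range_succ, add_assoc, le_refl]) (N + 1)
    have h2 : ∑ j ∈ Finset.range N, l ^ j * A (j + 1) ^ p ≤
        l⁻¹ * CH * (A 0 ^ p + ∑ j ∈ Finset.range (N + 1), l ^ j * B j ^ p) := by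
      rw [mul_assoc]
      refine le_trans ?_ (mul_le_mul_of_nonneg_left h1 (inv_pos.2 hl0).le)
      rw [Finset.sum_range_succ', mul_add, Finset.mul_sum]
      have : 0 ≤ l⁻¹ * (l ^ 0 * A 0 ^ p) := by have := hA0 0; positivity
      refine le_add_of_le_of_nonneg (Finset.sum_le_sum fun j _ => le_of_eq ?_) this
      rw [pow_succ]; field_simp
    have hBterm (j : ℕ) : l ^ j * B j ^ p =
        ‖deriv f (x j)‖ ^ p * ((1 / 2 : ℝ) ^ j) ^ (α + 2) := by
      rw [hlpow, hB, Real.mul_rpow (norm_nonneg _) (hu j).le, Real.rpow_sub (hu j)]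
      have : ((1 / 2 : ℝ) ^ j) ^ p ≠ 0 := by positivity
      field_simp
    rw [← ENNReal.ofReal_sum_of_nonneg fun j _ => by have := hA0 (j + 1); positivity]
    refine (ENNReal.ofReal_le_ofReal h2).trans ?_
    rw [ENNReal.ofReal_mul (by positivity), hD, mul_assoc]
    refine mul_le_mul' le_rfl ?_
    rw [ENNReal.ofReal_add (Real.rpow_nonneg (hA0 0) _)
      (Finset.sum_nonneg fun j _ => by have := hB0 j; positivity), add_mul, one_mul]
    refine add_le_add ?_ ?_
    · rw [← ENNReal.ofReal_rpow_of_nonneg (hA0 0) hp.le]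
      refine ENNReal.rpow_le_rpow ?_ hp.le
      simp only [hA, Finset.range_zero, Finset.sum_empty, add_zero]
      exact le_self_add
    · rw [ENNReal.ofReal_sum_of_nonneg fun j _ => by have := hB0 j; positivity]
      simp_rw [hBterm]
      refine (hsample _ (differentiableOn_deriv hf) x hx (N + 1)).trans ?_
      rw [mul_assoc]
      exact mul_le_mul' le_rfl (lintegral_deriv_le_dirichletNorm_rpow hp (by linarith) f)
  set I : ℕ → Set (Ico (0 : ℝ) 1) := fun j =>
    {t | (1 / 2 : ℝ) ^ (j + 1) < 1 - (t : ℝ) ∧ 1 - (t : ℝ) ≤ (1 / 2) ^ j} with hI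
  have hcover : ⋃ j, I j = univ := eq_univ_of_forall fun t => by
    obtain ⟨n, h1, h2⟩ := exists_nat_pow_near_of_lt_one (x := 1 - (t : ℝ)) (y := 1 / 2)
      (by linarith [t.2.2]) (by linarith [t.2.1]) (by norm_num) (by norm_num)
    exact mem_iUnion.2 ⟨n, h1, h2⟩
  have hIm (j : ℕ) : MeasurableSet (I j) := by
    change MeasurableSet ({t : Ico (0 : ℝ) 1 | (1 / 2 : ℝ) ^ (j + 1) < 1 - (t : ℝ)} ∩
      {t : Ico (0 : ℝ) 1 | 1 - (t : ℝ) ≤ (1 / 2) ^ j})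
    exact (measurableSet_lt (by fun_prop) (by fun_prop)).inter
      (measurableSet_le (by fun_prop) (by fun_prop))
  calc ∫⁻ t : Ico (0 : ℝ) 1, ENNReal.ofReal (‖f ((t : ℝ) : ℂ)‖ ^ P) ∂μ
      = ∫⁻ t in ⋃ j, I j, ENNReal.ofReal (‖f ((t : ℝ) : ℂ)‖ ^ P) ∂μ := by
        rw [hcover, Measure.restrict_univ]
    _ ≤ ∑' j, ∫⁻ t in I j, ENNReal.ofReal (‖f ((t : ℝ) : ℂ)‖ ^ P) ∂μ := lintegral_iUnion_le _ _
    _ ≤ ∑' j, ENNReal.ofReal Cμ * ENNReal.ofReal (l ^ j * A (j + 1) ^ p) ^ (P / p) := by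
        refine ENNReal.tsum_le_tsum fun j => ?_
        calc _ ≤ ∫⁻ _ in I j, ENNReal.ofReal (A (j + 1) ^ P) ∂μ :=
              setLIntegral_mono' (hIm j) fun t ht => ENNReal.ofReal_le_ofReal
                (Real.rpow_le_rpow (norm_nonneg _) (hmaj (j + 1) t t.2.1 ht.1.le) hP0.le)
          _ ≤ ENNReal.ofReal (A (j + 1) ^ P) *
                ENNReal.ofReal (Cμ * ((1 / 2 : ℝ) ^ j) ^ (P * ((α + 2 - p) / p))) := by
              rw [setLIntegral_const]
              exact mul_le_mul' le_rfl ((measure_mono fun t ht => ht.2).trans (hμ' _ (hu j)))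
          _ = _ := by
              have hAj := hA0 (j + 1)
              rw [ENNReal.ofReal_rpow_of_nonneg (by positivity) (by positivity),
                ← ENNReal.ofReal_mul (by positivity), ← ENNReal.ofReal_mul hCμ.le, hlpow,
                Real.mul_rpow (by positivity) (by positivity), ← Real.rpow_mul hAj,
                ← Real.rpow_mul (hu j).le, mul_div_cancel₀ _ hp.ne',
                show P * ((α + 2 - p) / p) = (α + 2 - p) * (P / p) by ring]
              congr 1; ring
    _ ≤ ENNReal.ofReal Cμ * (∑' j, ENNReal.ofReal (l ^ j * A (j + 1) ^ p)) ^ (P / p) := by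
        rw [ENNReal.tsum_mul_left]
        exact mul_le_mul' le_rfl (tsum_rpow_le_rpow_tsum ((one_le_div hp).2 hP) _)
    _ ≤ ENNReal.ofReal Cμ * (D * dirichletNorm p α f ^ p) ^ (P / p) := by gcongr
    _ = _ := by
        rw [ENNReal.mul_rpow_of_nonneg _ _ (by positivity), ← ENNReal.rpow_mul,
          mul_div_cancel₀ _ hp.ne', mul_assoc]

/-! ### The kernel operator from `L^P(μ)` to weighted `L^q` -/

theorem norm_one_sub_mul_ge {t : ℝ} {z : ℂ} (ht0 : 0 ≤ t) (ht1 : t ≤ 1) (hz : ‖z‖ ≤ 1) :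
    ((1 - ‖z‖) + (1 - t)) / 2 ≤ ‖1 - (t : ℂ) * z‖ := by
  have h1 := norm_sub_norm_le 1 ((t : ℂ) * z)
  rw [norm_one, norm_mul, Complex.norm_real, Real.norm_of_nonneg ht0] at h1
  have := norm_nonneg z
  nlinarith

/-- The positive operator `φ ↦ ∫ φ(t) |1 - t z|^{-(β+1)} dμ(t)` maps `L^P(μ)` into the weighted
Lebesgue space `L^q((1 - |z|²)^{β-1} dA)`, for `P ≤ q`. -/
theorem lintegral_kernel_rpow_le {P Q q q' β : ℝ} (hPQ : P.HolderConjugate Q)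
    (hqq : q.HolderConjugate q') (hPq : P ≤ q) (hβ : 0 < β) {μ : Measure (Ico (0 : ℝ) 1)}
    (hμ : IsCarleson (Q * ((β + 1) / q')) μ) :
    ∃ C : ℝ≥0∞, C ≠ ∞ ∧ ∀ φ : Ico (0 : ℝ) 1 → ℝ≥0∞, Measurable φ → ∫⁻ t, φ t ^ P ∂μ ≠ ∞ →
      ∫⁻ z, (∫⁻ t, φ t * ENNReal.ofReal (‖1 - ((t : ℝ) : ℂ) * z‖ ^ (-(β + 1))) ∂μ) ^ q *
        ENNReal.ofReal ((1 - ‖z‖ ^ 2) ^ (β - 1)) ∂areaMeasure ≤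
        C * (∫⁻ t, φ t ^ P ∂μ) ^ (q / P) := by
  have := hμ.isFiniteMeasure
  have hP0 := hPQ.pos
  have hQ0 := hPQ.symm.pos
  have hq0 := hqq.pos
  have hq'0 := hqq.symm.pos
  set σ := Q * ((β + 1) / q') with hσ
  have hσ0 : 0 < σ := by positivity
  -- The exponent of the Schur weight: `e q < β` keeps `(1 - |z|²)^(β-1-eq)` integrable, and `e Q <
  -- σ` keeps the integral of `(1 - t)^(-eQ)` against `μ` under control.
  obtain ⟨e, he0, heβ, heσ⟩ : ∃ e : ℝ, 0 < e ∧ e * q < β ∧ e * Q < σ := by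
    refine ⟨min (β / (2 * q)) (σ / (2 * Q)), by positivity, ?_, ?_⟩
    · calc _ ≤ β / (2 * q) * q := by gcongr; exact min_le_left _ _
        _ = β / 2 := by field_simp
        _ < β := by linarith
    · calc _ ≤ σ / (2 * Q) * Q := by gcongr; exact min_le_right _ _
        _ = σ / 2 := by field_simp
        _ < σ := by linarith
  obtain ⟨C₁, hC₁, hint₁⟩ := hμ.lintegral_le (e := e * Q) (N := σ) (by positivity) heσ
    (by have : 0 < e * Q := by positivity
        linarith)
  obtain ⟨C₂, hC₂, hint₂⟩ := lintegral_norm_one_sub_mul_rpow_le (a := β - 1 - e * q) (M := β + 1)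
    (by linarith) (by have : 0 < e * q := by positivity
                      linarith)
  set C₃ : ℝ≥0∞ := (ENNReal.ofReal (2 ^ σ) * C₁) ^ (q / Q) * ENNReal.ofReal (3 ^ |-(e * q)|) with hC₃
  have hC₃fin : C₃ ≠ ∞ := ENNReal.mul_ne_top
    (ENNReal.rpow_ne_top_of_nonneg (by positivity) (by finiteness)) ENNReal.ofReal_ne_top
  refine ⟨C₃ * C₂, by finiteness, fun φ hφ hφfin => ?_⟩
  set X := ∫⁻ t, φ t ^ P ∂μ with hX
  set k : Ico (0 : ℝ) 1 → ℂ → ℝ := fun t z => ‖1 - ((t : ℝ) : ℂ) * z‖ with hk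
  have hkpos (t : Ico (0 : ℝ) 1) (z : ℂ) (hz : z ∈ unitDisc) : 0 < k t z :=
    lt_of_lt_of_le (by linarith [mem_unitDisc.1 hz, t.2.2])
      (norm_one_sub_mul_ge t.2.1 t.2.2.le (mem_unitDisc.1 hz).le)
  have hu (t : Ico (0 : ℝ) 1) : 0 < 1 - (t : ℝ) := by linarith [t.2.2]
  have hqP : 0 ≤ q / P - 1 := by
    rw [sub_nonneg, one_le_div hP0]; exact hPq
  have hXfin : X ^ (q / P - 1) ≠ ∞ := ENNReal.rpow_ne_top_of_nonneg hqP hφfin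
  -- Hölder with exponents `1/q`, `1/P - 1/q`, `1/Q`, the middle one being nonnegative as `P ≤ q`.
  -- The powers of `φ` add up to `1`, those of `1 - t` cancel, and those of the kernel add up to
  -- `-(β+1)` because `σ/Q = (β+1)/q'`.
  have hHolder (z : ℂ) (hz : z ∈ unitDisc) :
      (∫⁻ t, φ t * ENNReal.ofReal (k t z ^ (-(β + 1))) ∂μ) ^ q ≤
      (∫⁻ t, φ t ^ P * ENNReal.ofReal (k t z ^ (-(β + 1)) * (1 - (t : ℝ)) ^ (e * q)) ∂μ) *
        X ^ (q / P - 1) *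
        (∫⁻ t, ENNReal.ofReal (k t z ^ (-σ) * (1 - (t : ℝ)) ^ (-(e * Q))) ∂μ) ^ (q / Q) := by
    have hm₁ : Measurable fun t : Ico (0 : ℝ) 1 =>
        φ t ^ P * ENNReal.ofReal (k t z ^ (-(β + 1)) * (1 - (t : ℝ)) ^ (e * q)) := by
      simp only [hk]
      fun_prop
    have hm₂ : Measurable fun t : Ico (0 : ℝ) 1 => φ t ^ P := by fun_prop
    have hm₃ : Measurable fun t : Ico (0 : ℝ) 1 =>
        ENNReal.ofReal (k t z ^ (-σ) * (1 - (t : ℝ)) ^ (-(e * Q))) := by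
      simp only [hk]
      fun_prop
    have h := ENNReal.lintegral_prod_norm_pow_le (μ := μ) (Finset.univ : Finset (Fin 3))
      (f := ![fun t => φ t ^ P * ENNReal.ofReal (k t z ^ (-(β + 1)) * (1 - (t : ℝ)) ^ (e * q)),
        fun t => φ t ^ P, fun t => ENNReal.ofReal (k t z ^ (-σ) * (1 - (t : ℝ)) ^ (-(e * Q)))])
      (p := ![1 / q, 1 / P - 1 / q, 1 / Q])
      (by
        intro i _
        fin_cases i
        · exact hm₁.aemeasurable
        · exact hm₂.aemeasurable
        · exact hm₃.aemeasurable)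
      (by
        have := hPQ.inv_add_inv_eq_one
        simp only [Fin.sum_univ_three, Matrix.cons_val, one_div]
        linarith)
      (by
        intro i _
        fin_cases i
        · simpa using hq0.le
        · simpa using inv_anti₀ hP0 hPq
        · simpa using hQ0.le)
    simp only [Fin.prod_univ_three, Matrix.cons_val] at h
    have h2 := ENNReal.rpow_le_rpow h hq0.le
    rw [ENNReal.mul_rpow_of_nonneg _ _ hq0.le, ENNReal.mul_rpow_of_nonneg _ _ hq0.le,
      ← ENNReal.rpow_mul, ← ENNReal.rpow_mul, ← ENNReal.rpow_mul, one_div_mul_cancel hq0.ne',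
      ENNReal.rpow_one, show (1 / P - 1 / q) * q = q / P - 1 by field_simp,
      show 1 / Q * q = q / Q by ring] at h2
    refine le_trans (le_of_eq ?_) h2
    congr 1
    refine lintegral_congr fun t => ?_
    have hkt := hkpos t z hz
    have hut := hu t
    rw [ENNReal.mul_rpow_of_nonneg _ _ (by positivity), ← ENNReal.rpow_mul, ← ENNReal.rpow_mul,
      ENNReal.ofReal_rpow_of_pos (by positivity), ENNReal.ofReal_rpow_of_pos (by positivity),
      mul_right_comm (φ t ^ _), ← ENNReal.rpow_add_of_nonneg _ _ (by positivity)
        (mul_nonneg hP0.le (sub_nonneg.2 (one_div_le_one_div_of_le hP0 hPq))),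
      show P * (1 / q) + P * (1 / P - 1 / q) = 1 by field_simp; ring, ENNReal.rpow_one, mul_assoc,
      ← ENNReal.ofReal_mul (by positivity)]
    congr 2
    rw [Real.mul_rpow (by positivity) (by positivity), Real.mul_rpow (by positivity) (by positivity),
      ← Real.rpow_mul hkt.le, ← Real.rpow_mul hkt.le, ← Real.rpow_mul hut.le,
      ← Real.rpow_mul hut.le, mul_mul_mul_comm, ← Real.rpow_add hkt, ← Real.rpow_add hut,
      show e * q * (1 / q) + -(e * Q) * (1 / Q) = 0 by field_simp; ring, Real.rpow_zero, mul_one]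
    congr 1
    have h3 := hqq.inv_add_inv_eq_one
    have h4 : σ * (1 / Q) = (β + 1) * q'⁻¹ := by rw [hσ]; field_simp
    rw [neg_mul, neg_mul, h4]
    linear_combination (β + 1) * h3
  have hsecond (z : ℂ) (hz : z ∈ unitDisc) :
      (∫⁻ t, ENNReal.ofReal (k t z ^ (-σ) * (1 - (t : ℝ)) ^ (-(e * Q))) ∂μ) ^ (q / Q) ≤
        C₃ * ENNReal.ofReal ((1 - ‖z‖ ^ 2) ^ (-(e * q))) := by
    have hz1 := mem_unitDisc.1 hz
    have hd : 0 < 1 - ‖z‖ := by linarith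
    have h1 : ∫⁻ t, ENNReal.ofReal (k t z ^ (-σ) * (1 - (t : ℝ)) ^ (-(e * Q))) ∂μ ≤
        ENNReal.ofReal (2 ^ σ) * C₁ * ENNReal.ofReal ((1 - ‖z‖) ^ (-(e * Q))) := by
      calc _ ≤ ∫⁻ t : Ico (0 : ℝ) 1, ENNReal.ofReal (2 ^ σ) * ENNReal.ofReal
            (((1 - ‖z‖) + (1 - (t : ℝ))) ^ (-σ) * (1 - (t : ℝ)) ^ (-(e * Q))) ∂μ := by
            refine lintegral_mono fun t => ?_
            have hut := hu t
            rw [← ENNReal.ofReal_mul (by positivity), ← mul_assoc]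
            refine ENNReal.ofReal_le_ofReal (mul_le_mul_of_nonneg_right ?_ (by positivity))
            refine (Real.rpow_le_rpow_of_nonpos (by positivity)
              (norm_one_sub_mul_ge t.2.1 t.2.2.le hz1.le) (by linarith)).trans_eq ?_
            rw [Real.div_rpow (by positivity) (by norm_num), Real.rpow_neg (x := 2) (by norm_num),
              div_inv_eq_mul, mul_comm]
        _ ≤ _ := by
            rw [lintegral_const_mul' _ _ ENNReal.ofReal_ne_top, mul_assoc]
            refine mul_le_mul' le_rfl ((hint₁ _ hd).trans_eq ?_)
            congr 3; ring
    refine (ENNReal.rpow_le_rpow h1 (by positivity)).trans ?_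
    rw [ENNReal.mul_rpow_of_nonneg _ _ (by positivity), hC₃, mul_assoc,
      ← ENNReal.ofReal_mul (by positivity), ENNReal.ofReal_rpow_of_pos (by positivity),
      ← Real.rpow_mul hd.le]
    refine mul_le_mul' le_rfl (ENNReal.ofReal_le_ofReal ?_)
    rw [show -(e * Q) * (q / Q) = -(e * q) by field_simp]
    have := norm_nonneg z
    exact rpow_le_three_rpow_mul _ hd (by nlinarith) (by nlinarith)
  have hmeas : Measurable (Function.uncurry fun (z : ℂ) (t : Ico (0 : ℝ) 1) =>
      φ t ^ P * ENNReal.ofReal (k t z ^ (-(β + 1)) * (1 - (t : ℝ)) ^ (e * q)) *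
        ENNReal.ofReal ((1 - ‖z‖ ^ 2) ^ (β - 1 - e * q))) := by
    simp only [hk, Function.uncurry_def]
    fun_prop
  calc _ ≤ ∫⁻ z, C₃ * X ^ (q / P - 1) * ∫⁻ t, φ t ^ P *
          ENNReal.ofReal (k t z ^ (-(β + 1)) * (1 - (t : ℝ)) ^ (e * q)) *
          ENNReal.ofReal ((1 - ‖z‖ ^ 2) ^ (β - 1 - e * q)) ∂μ ∂areaMeasure := by
        refine lintegral_mono_ae ?_
        filter_upwards [ae_mem_unitDisc] with z hz
        have hz0 := one_sub_norm_sq_pos hz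
        rw [lintegral_mul_const' _ _ ENNReal.ofReal_ne_top]
        calc _ ≤ (∫⁻ t, φ t ^ P * ENNReal.ofReal (k t z ^ (-(β + 1)) * (1 - (t : ℝ)) ^ (e * q)) ∂μ) *
              X ^ (q / P - 1) * (C₃ * ENNReal.ofReal ((1 - ‖z‖ ^ 2) ^ (-(e * q)))) *
              ENNReal.ofReal ((1 - ‖z‖ ^ 2) ^ (β - 1)) :=
              mul_le_mul' ((hHolder z hz).trans (mul_le_mul' le_rfl (hsecond z hz))) le_rfl
          _ = _ := by
              rw [show β - 1 - e * q = -(e * q) + (β - 1) by ring, Real.rpow_add hz0,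
                ENNReal.ofReal_mul (by positivity)]
              ring
    _ = C₃ * X ^ (q / P - 1) * ∫⁻ t, ∫⁻ z, φ t ^ P *
          ENNReal.ofReal (k t z ^ (-(β + 1)) * (1 - (t : ℝ)) ^ (e * q)) *
          ENNReal.ofReal ((1 - ‖z‖ ^ 2) ^ (β - 1 - e * q)) ∂areaMeasure ∂μ := by
        rw [lintegral_const_mul' _ _ (ENNReal.mul_ne_top hC₃fin hXfin),
          lintegral_lintegral_swap hmeas.aemeasurable]
    -- The Forelli–Rudin estimate in `z` yields `(1 - t)^(-eq)`, which cancels the Schur weight.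
    _ ≤ C₃ * X ^ (q / P - 1) * ∫⁻ t, C₂ * φ t ^ P ∂μ := by
        refine mul_le_mul' le_rfl (lintegral_mono fun t => ?_)
        have hut := hu t
        calc _ = ∫⁻ z, φ t ^ P * ENNReal.ofReal ((1 - (t : ℝ)) ^ (e * q)) *
              ENNReal.ofReal (k t z ^ (-(β + 1)) * (1 - ‖z‖ ^ 2) ^ (β - 1 - e * q)) ∂areaMeasure := by
              refine lintegral_congr fun z => ?_
              have : 0 ≤ k t z := norm_nonneg _
              rw [ENNReal.ofReal_mul (by positivity), ENNReal.ofReal_mul (by positivity)]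
              ring
          _ = φ t ^ P * ENNReal.ofReal ((1 - (t : ℝ)) ^ (e * q)) * ∫⁻ z,
              ENNReal.ofReal (k t z ^ (-(β + 1)) * (1 - ‖z‖ ^ 2) ^ (β - 1 - e * q)) ∂areaMeasure :=
              lintegral_const_mul _ (by simp only [hk]; fun_prop)
          _ ≤ φ t ^ P * ENNReal.ofReal ((1 - (t : ℝ)) ^ (e * q)) *
              (C₂ * ENNReal.ofReal ((1 - (t : ℝ)) ^ (-(e * q)))) := by
              refine mul_le_mul' le_rfl ((hint₂ t t.2.1 t.2.2).trans_eq ?_)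
              congr 3; ring
          _ = C₂ * φ t ^ P * ENNReal.ofReal ((1 - (t : ℝ)) ^ (e * q) * (1 - (t : ℝ)) ^ (-(e * q))) := by
              rw [ENNReal.ofReal_mul (by positivity)]; ring
          _ = _ := by
              rw [← Real.rpow_add hut, add_neg_cancel, Real.rpow_zero, ENNReal.ofReal_one, mul_one]
    _ = C₃ * C₂ * (X ^ (q / P - 1) * X) := by
        rw [lintegral_const_mul' _ _ hC₂, ← hX]; ring
    _ = _ := by
        conv_rhs => rw [← sub_add_cancel (q / P) 1]
        rw [ENNReal.rpow_add_of_nonneg _ _ hqP zero_le_one, ENNReal.rpow_one]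

/-! ### Taylor coefficients, moments and absolute convergence -/

theorem norm_taylorCoeff_mul_pow_le {h : ℂ → ℂ} (hd : DifferentiableOn ℂ h unitDisc) (k : ℕ)
    {r : ℝ} (hr0 : 0 < r) (hr1 : r < 1) :
    ENNReal.ofReal (2 * Real.pi * ‖taylorCoeff h k‖ * r ^ k) ≤
      ∫⁻ θ in Ioo (-Real.pi) Real.pi,
        ENNReal.ofReal ‖h (r * (Real.cos θ + Real.sin θ * Complex.I))‖ := by
  have hsub : Metric.closedBall (0 : ℂ) r ⊆ unitDisc := Metric.closedBall_subset_ball hr1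
  have hcauchy := (hd.mono hsub).circleIntegral_one_div_sub_center_pow_smul hr0 k
  have hmap (θ : ℝ) : circleMap 0 r θ = r * (Real.cos θ + Real.sin θ * Complex.I) := by
    simp [circleMap, Complex.exp_mul_I]
  have hmem (θ : ℝ) : circleMap 0 r θ ∈ unitDisc := hsub (circleMap_mem_closedBall _ hr0.le θ)
  have hcont : Continuous fun θ : ℝ => ‖h (circleMap 0 r θ)‖ :=
    (hd.continuousOn.comp_continuous (continuous_circleMap _ _) hmem).norm
  have h1 : 2 * Real.pi * ‖taylorCoeff h k‖ =
      ‖∮ z in C(0, r), (1 / (z - 0) ^ (k + 1)) • h z‖ := by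
    rw [hcauchy, taylorCoeff, smul_eq_mul, div_mul_eq_mul_div, norm_div, norm_div, norm_mul]
    simp [abs_of_pos Real.pi_pos, mul_div_assoc]
  have h2 : ‖∮ z in C(0, r), (1 / (z - 0) ^ (k + 1)) • h z‖ ≤
      ∫ θ in (0 : ℝ)..2 * Real.pi, r ^ (-(k : ℤ)) * ‖h (circleMap 0 r θ)‖ := by
    rw [circleIntegral]
    refine (intervalIntegral.norm_integral_le_integral_norm (by positivity)).trans_eq ?_
    refine intervalIntegral.integral_congr fun θ _ => ?_
    simp only [deriv_circleMap, norm_smul, norm_mul, norm_circleMap_zero, abs_of_pos hr0,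
      Complex.norm_I, mul_one, sub_zero, norm_div, norm_one, norm_pow, zpow_neg, zpow_natCast]
    field_simp
    ring
  have h3 : ∫ θ in (0 : ℝ)..2 * Real.pi, ‖h (circleMap 0 r θ)‖ =
      ∫ θ in Ioo (-Real.pi) Real.pi, ‖h (circleMap 0 r θ)‖ := by
    have hper : Function.Periodic (fun θ => ‖h (circleMap 0 r θ)‖) (2 * Real.pi) := fun θ => by
      simp only [periodic_circleMap 0 r θ]
    have := hper.intervalIntegral_add_eq 0 (-Real.pi)
    rw [zero_add, show -Real.pi + 2 * Real.pi = Real.pi by ring] at this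
    rw [this, intervalIntegral.integral_of_le (by linarith [Real.pi_pos]), integral_Ioc_eq_integral_Ioo]
  rw [← h1, intervalIntegral.integral_const_mul, h3, zpow_neg, zpow_natCast,
    inv_mul_eq_div, le_div_iff₀ (by positivity)] at h2
  refine (ENNReal.ofReal_le_ofReal h2).trans_eq ?_
  simp_rw [← hmap]
  refine ofReal_integral_eq_lintegral_ofReal ?_ (Filter.Eventually.of_forall fun θ => norm_nonneg _)
  exact (hcont.integrableOn_Icc).mono_set Ioo_subset_Icc_self

/-- Integrate Cauchy's estimate over the radii `1 - 2d ≤ r ≤ 1 - d` with `d = 1/(4(k+1))`. There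
`r^k ≥ 1/2` by Bernoulli and the weight is comparable to `d^η`, so the annulus of width `d`
contributes `d^(η+1)`. -/
theorem norm_taylorCoeff_le (η : ℝ) :
    ∃ C : ℝ≥0∞, C ≠ ∞ ∧ ∀ h : ℂ → ℂ, DifferentiableOn ℂ h unitDisc → ∀ k : ℕ,
      ENNReal.ofReal ‖taylorCoeff h k‖ ≤ C * ENNReal.ofReal (((k : ℝ) + 1) ^ (η + 1)) *
        ∫⁻ z, ENNReal.ofReal (‖h z‖ * (1 - ‖z‖ ^ 2) ^ η) ∂areaMeasure := by
  refine ⟨ENNReal.ofReal (4 * 3 ^ |η| * 2 ^ (η + 1) / Real.pi) * ENNReal.ofReal Real.pi,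
    by finiteness, fun h hd k => ?_⟩
  have hpi := Real.pi_pos
  obtain ⟨d, hd'⟩ : ∃ d : ℝ, d = 1 / (4 * ((k : ℝ) + 1)) := ⟨_, rfl⟩
  have hk0 : (0 : ℝ) ≤ k := k.cast_nonneg
  have hd0 : 0 < d := by rw [hd']; positivity
  have hd4 : d * (4 * ((k : ℝ) + 1)) = 1 := by rw [hd']; field_simp
  have hd1 : d ≤ 1 / 4 := by nlinarith
  set W := ∫⁻ z, ENNReal.ofReal (‖h z‖ * (1 - ‖z‖ ^ 2) ^ η) ∂areaMeasure with hW
  have hmeas : Measurable (unitDisc.indicator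
      fun z => ENNReal.ofReal (‖h z‖ * (1 - ‖z‖ ^ 2) ^ η)) := by
    have h1 : Measurable (unitDisc.indicator h) := by
      classical
      rw [← piecewise_eq_indicator]
      exact hd.continuousOn.measurable_piecewise continuousOn_const measurableSet_unitDisc
    have h2 : (unitDisc.indicator fun z => ENNReal.ofReal (‖h z‖ * (1 - ‖z‖ ^ 2) ^ η)) =
        fun z => ENNReal.ofReal (‖unitDisc.indicator h z‖ * (1 - ‖z‖ ^ 2) ^ η) := by
      ext z
      by_cases hz : z ∈ unitDisc <;> simp [hz]
    rw [h2]
    fun_prop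
  have hlow : ENNReal.ofReal (Real.pi / 2 * (3 ^ |η|)⁻¹ * (2 * d) ^ η * ‖taylorCoeff h k‖ * d) ≤
      ENNReal.ofReal Real.pi * W := by
    calc ENNReal.ofReal (Real.pi / 2 * (3 ^ |η|)⁻¹ * (2 * d) ^ η * ‖taylorCoeff h k‖ * d)
        = ∫⁻ _ in Icc (1 - 2 * d) (1 - d),
            ENNReal.ofReal (Real.pi / 2 * (3 ^ |η|)⁻¹ * (2 * d) ^ η * ‖taylorCoeff h k‖) := by
          rw [setLIntegral_const, Real.volume_Icc, ← ENNReal.ofReal_mul (by positivity)]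
          congr 2; ring
      _ ≤ ∫⁻ r in Icc (1 - 2 * d) (1 - d), ∫⁻ θ in Ioo (-Real.pi) Real.pi,
            ENNReal.ofReal r * ENNReal.ofReal
              (‖h (r * (Real.cos θ + Real.sin θ * Complex.I))‖ *
                (1 - ‖(r * (Real.cos θ + Real.sin θ * Complex.I) : ℂ)‖ ^ 2) ^ η) := by
          refine setLIntegral_mono' measurableSet_Icc fun r ⟨hr1, hr2⟩ => ?_
          have hr0 : 0 < r := by linarith
          have hn (θ : ℝ) : ‖(r * (Real.cos θ + Real.sin θ * Complex.I) : ℂ)‖ = r := by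
            rw [← Complex.polarCoord_symm_apply (r, θ), Complex.norm_polarCoord_symm, abs_of_pos hr0]
          have hr3 : 0 < 1 - r ^ 2 := by nlinarith
          have hpow : 1 / 2 ≤ r ^ k := by
            have h1 := one_add_mul_le_pow (show (-2 : ℝ) ≤ -(2 * d) by linarith) k
            have h2 : (1 + -(2 * d)) ^ k ≤ r ^ k := by
              refine pow_le_pow_left₀ (by linarith) (by linarith) k
            nlinarith
          have hwt : (3 ^ |η|)⁻¹ * (2 * d) ^ η ≤ (1 - r ^ 2) ^ η := by
            rw [inv_mul_le_iff₀ (by positivity)]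
            exact rpow_le_three_rpow_mul η (by positivity) (by nlinarith) (by nlinarith)
          simp_rw [hn]
          calc _ ≤ ENNReal.ofReal (r * (1 - r ^ 2) ^ η) *
                ENNReal.ofReal (2 * Real.pi * ‖taylorCoeff h k‖ * r ^ k) := by
                rw [← ENNReal.ofReal_mul (by positivity)]
                refine ENNReal.ofReal_le_ofReal ?_
                calc _ = (1 / 2 * ((3 ^ |η|)⁻¹ * (2 * d) ^ η)) *
                      (2 * Real.pi * ‖taylorCoeff h k‖ * (1 / 2)) := by ring
                  _ ≤ _ := by
                    gcongr
                    linarith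
            _ ≤ ENNReal.ofReal (r * (1 - r ^ 2) ^ η) * ∫⁻ θ in Ioo (-Real.pi) Real.pi,
                ENNReal.ofReal ‖h (r * (Real.cos θ + Real.sin θ * Complex.I))‖ := by
                gcongr
                exact norm_taylorCoeff_mul_pow_le hd k hr0 (by linarith)
            _ = _ := by
                rw [← lintegral_const_mul' _ _ ENNReal.ofReal_ne_top]
                refine lintegral_congr fun θ => ?_
                rw [ENNReal.ofReal_mul hr0.le, ENNReal.ofReal_mul (norm_nonneg _), mul_assoc]
                congr 1
                exact mul_comm _ _
      _ ≤ ∫⁻ r in Ioo (0 : ℝ) 1, ∫⁻ θ in Ioo (-Real.pi) Real.pi,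
            ENNReal.ofReal r * ENNReal.ofReal
              (‖h (r * (Real.cos θ + Real.sin θ * Complex.I))‖ *
                (1 - ‖(r * (Real.cos θ + Real.sin θ * Complex.I) : ℂ)‖ ^ 2) ^ η) :=
          lintegral_mono_set fun r hr => ⟨by linarith [hr.1], by linarith [hr.2]⟩
      _ = ∫⁻ z in unitDisc, ENNReal.ofReal (‖h z‖ * (1 - ‖z‖ ^ 2) ^ η) :=
          (setLIntegral_unitDisc_eq_polar hmeas).symm
      _ ≤ _ := (setLIntegral_le_areaMeasure le_rfl _).trans
          (mul_le_mul' le_rfl (setLIntegral_le_lintegral _ _))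
  rw [mul_right_comm, mul_assoc (ENNReal.ofReal _) (ENNReal.ofReal Real.pi), mul_right_comm]
  refine le_trans (le_of_eq ?_) (mul_le_mul' le_rfl hlow)
  rw [← ENNReal.ofReal_mul (by positivity), ← ENNReal.ofReal_mul (by positivity)]
  congr 1
  have h2d : 2 * d = (2 * ((k : ℝ) + 1))⁻¹ := by rw [hd']; field_simp; norm_num
  have hd2 : d = (2 * ((k : ℝ) + 1))⁻¹ / 2 := by rw [← h2d]; ring
  have hx : (2 ^ (η + 1) * ((k : ℝ) + 1) ^ (η + 1)) * ((2 * d) ^ η * d) = 1 / 2 := by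
    rw [h2d, hd2, ← Real.mul_rpow zero_le_two (by positivity), Real.inv_rpow (by positivity),
      Real.rpow_add_one (by positivity)]
    field_simp
  calc ‖taylorCoeff h k‖ = 2 * ‖taylorCoeff h k‖ *
        ((2 ^ (η + 1) * ((k : ℝ) + 1) ^ (η + 1)) * ((2 * d) ^ η * d)) := by rw [hx]; ring
    _ = _ := by field_simp; norm_num; ring

/-- Since `t^k ≤ exp(-k(1-t))`, it is at most a constant times `(1 + (k+1)(1-t))^(-N)` with `N = s +
1`; then `IsCarleson.lintegral_le` applies at scale `d = 1/(k+1)`. -/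
theorem IsCarleson.integral_pow_le {s : ℝ} (hs : 0 < s) {μ : Measure (Ico (0 : ℝ) 1)}
    (hμ : IsCarleson s μ) :
    ∃ C : ℝ, 0 ≤ C ∧ ∀ k : ℕ, ∫ t : Ico (0 : ℝ) 1, (t : ℝ) ^ k ∂μ ≤ C * ((k : ℝ) + 1) ^ (-s) := by
  obtain ⟨C, hC, hint⟩ := hμ.lintegral_le (e := 0) (N := s + 1) le_rfl hs (by linarith)
  set N := s + 1 with hN
  have hN1 : 1 ≤ N := by linarith
  refine ⟨2 ^ N * N ^ N * C.toReal, by positivity, fun k => ?_⟩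
  have hk0 : (0 : ℝ) ≤ k := k.cast_nonneg
  have hk1 : (0 : ℝ) < k + 1 := by linarith
  have hpt (t : Ico (0 : ℝ) 1) : ENNReal.ofReal ((t : ℝ) ^ k) ≤
      ENNReal.ofReal (2 ^ N * N ^ N * ((k : ℝ) + 1) ^ (-N)) *
        ENNReal.ofReal ((1 / ((k : ℝ) + 1) + (1 - (t : ℝ))) ^ (-N) * (1 - (t : ℝ)) ^ (-(0 : ℝ))) := by
    obtain ⟨t, ht0, ht1⟩ := t
    have hu : 0 ≤ 1 - t := by linarith
    rw [← ENNReal.ofReal_mul (by positivity)]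
    refine ENNReal.ofReal_le_ofReal ?_
    simp only [neg_zero, Real.rpow_zero, mul_one]
    rw [mul_assoc, ← Real.mul_rpow hk1.le (by positivity),
      show ((k : ℝ) + 1) * (1 / ((k : ℝ) + 1) + (1 - t)) = 1 + (k + 1) * (1 - t) by field_simp,
      Real.rpow_neg (by positivity), ← div_eq_mul_inv, le_div_iff₀ (by positivity)]
    have hexp : t ^ k ≤ Real.exp (-(k * (1 - t))) := by
      have := Real.add_one_le_exp (-(1 - t))
      calc t ^ k ≤ Real.exp (-(1 - t)) ^ k := pow_le_pow_left₀ ht0 (by linarith) k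
        _ = _ := by rw [← Real.exp_nat_mul]; congr 1; ring
    have hpoly : (1 + (k + 1) * (1 - t)) ^ N ≤ 2 ^ N * N ^ N * Real.exp (k * (1 - t)) := by
      have h1 := Real.add_one_le_exp (k * (1 - t) / N)
      calc (1 + (k + 1) * (1 - t)) ^ N ≤ (2 * N * Real.exp (k * (1 - t) / N)) ^ N := by
            refine Real.rpow_le_rpow (by positivity) ?_ (by linarith)
            calc 1 + (k + 1) * (1 - t) ≤ 2 * N * (k * (1 - t) / N + 1) := by
                  have : 2 * N * (k * (1 - t) / N + 1) = 2 * (k * (1 - t)) + 2 * N := by field_simp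
                  rw [this]
                  have : 0 ≤ k * (1 - t) := by positivity
                  linarith
              _ ≤ _ := by gcongr
        _ = _ := by
            rw [Real.mul_rpow (by positivity) (by positivity),
              Real.mul_rpow (by positivity) (by positivity), ← Real.exp_mul]
            congr 2; field_simp
    calc _ ≤ Real.exp (-(k * (1 - t))) * (2 ^ N * N ^ N * Real.exp (k * (1 - t))) := by gcongr
      _ = 2 ^ N * N ^ N * (Real.exp (-(k * (1 - t))) * Real.exp (k * (1 - t))) := by ring
      _ = _ := by rw [← Real.exp_add, neg_add_cancel, Real.exp_zero, mul_one]
  have hlint : ∫⁻ t : Ico (0 : ℝ) 1, ENNReal.ofReal ((t : ℝ) ^ k) ∂μ ≤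
      ENNReal.ofReal (2 ^ N * N ^ N * C.toReal * ((k : ℝ) + 1) ^ (-s)) := by
    calc _ ≤ _ := lintegral_mono hpt
      _ ≤ ENNReal.ofReal (2 ^ N * N ^ N * ((k : ℝ) + 1) ^ (-N)) *
          (C * ENNReal.ofReal ((1 / ((k : ℝ) + 1)) ^ (s - 0 - N))) := by
          rw [lintegral_const_mul' _ _ ENNReal.ofReal_ne_top]
          exact mul_le_mul' le_rfl (hint _ (by positivity))
      _ = _ := by
          conv_lhs => rw [← ENNReal.ofReal_toReal hC]
          rw [← ENNReal.ofReal_mul (by positivity), ← ENNReal.ofReal_mul (by positivity)]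
          congr 1
          rw [one_div, Real.inv_rpow hk1.le, ← Real.rpow_neg hk1.le, sub_zero,
            show -s = -N + -(s - N) by ring, Real.rpow_add hk1]
          ring
  have h0 : 0 ≤ᵐ[μ] fun t : Ico (0 : ℝ) 1 => (t : ℝ) ^ k :=
    Filter.Eventually.of_forall fun t => pow_nonneg t.2.1 k
  rw [integral_eq_lintegral_of_nonneg_ae h0 (by fun_prop)]
  exact ENNReal.toReal_le_of_le_ofReal (by positivity) hlint

theorem taylorCoeff_succ (f : ℂ → ℂ) (k : ℕ) :
    taylorCoeff f (k + 1) = taylorCoeff (deriv f) k / (k + 1) := by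
  rw [taylorCoeff, taylorCoeff, iteratedDeriv_succ', Nat.factorial_succ, div_div]
  push_cast
  ring

/-- The coefficients of `f'` grow at most like `(k+1)^(η+1)`; passing to `f` divides by `k + 1`, and
the moments contribute `(k+1)^(-s)`. The terms are thus bounded by a multiple of `(k+1)^(η-s)`, with
`η - s < -1`. -/
theorem summable_taylorCoeff_mul_integral_pow {s η : ℝ} (hs : 0 < s) (hη : η + 1 < s)
    {μ : Measure (Ico (0 : ℝ) 1)} (hμ : IsCarleson s μ) {f : ℂ → ℂ}
    (hf : DifferentiableOn ℂ f unitDisc)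
    (hW : ∫⁻ z, ENNReal.ofReal (‖deriv f z‖ * (1 - ‖z‖ ^ 2) ^ η) ∂areaMeasure ≠ ∞) :
    Summable fun k => ‖taylorCoeff f k‖ * ∫ t : Ico (0 : ℝ) 1, (t : ℝ) ^ k ∂μ := by
  obtain ⟨C, hC, hcoeff⟩ := norm_taylorCoeff_le η
  obtain ⟨C', hC', hmom⟩ := hμ.integral_pow_le hs
  set W := ∫⁻ z, ENNReal.ofReal (‖deriv f z‖ * (1 - ‖z‖ ^ 2) ^ η) ∂areaMeasure
  rw [← summable_nat_add_iff 1]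
  have hsum : Summable fun k : ℕ => C.toReal * W.toReal * C' * (((k + 1 : ℕ) : ℝ) ^ (η - s)) :=
    ((summable_nat_add_iff 1).2 (Real.summable_nat_rpow.2 (by linarith))).mul_left _
  refine Summable.of_nonneg_of_le (fun k => ?_) (fun k => ?_) hsum
  · exact mul_nonneg (norm_nonneg _) (integral_nonneg fun t => pow_nonneg t.2.1 _)
  · have hk1 : (0 : ℝ) < k + 1 := by positivity
    have h1 : ‖taylorCoeff (deriv f) k‖ ≤ C.toReal * ((k : ℝ) + 1) ^ (η + 1) * W.toReal := by
      have : _ ≤ C * _ * W := hcoeff _ (differentiableOn_deriv hf) k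
      rw [← ENNReal.ofReal_toReal hC, ← ENNReal.ofReal_toReal hW,
        ← ENNReal.ofReal_mul (by positivity), ← ENNReal.ofReal_mul (by positivity)] at this
      exact (ENNReal.ofReal_le_ofReal_iff (by positivity)).1 this
    have h2 : ∫ t : Ico (0 : ℝ) 1, (t : ℝ) ^ (k + 1) ∂μ ≤ C' * ((k : ℝ) + 1) ^ (-s) := by
      refine (hmom (k + 1)).trans (mul_le_mul_of_nonneg_left ?_ hC')
      push_cast
      exact Real.rpow_le_rpow_of_nonpos hk1 (by linarith) (by linarith)
    have h3 : ‖taylorCoeff f (k + 1)‖ = ‖taylorCoeff (deriv f) k‖ / (k + 1) := by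
      rw [taylorCoeff_succ, norm_div]
      congr 1
      rw [show (k : ℂ) + 1 = ((k + 1 : ℕ) : ℂ) by push_cast; ring, Complex.norm_natCast]
      push_cast; ring
    rw [h3]
    calc _ ≤ C.toReal * ((k : ℝ) + 1) ^ (η + 1) * W.toReal / (k + 1) *
          (C' * ((k : ℝ) + 1) ^ (-s)) := by
          refine mul_le_mul ?_ h2 (integral_nonneg fun t => pow_nonneg t.2.1 _) (by positivity)
          gcongr
      _ = _ := by
          push_cast
          rw [Real.rpow_add_one hk1.ne', show η - s = η + -s by ring, Real.rpow_add hk1]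
          field_simp

/-- Write `|f'| = |f'|^p |f'|^(1-p)` and trade the second factor for a power of the weight, using
the pointwise growth of order `(α+2)/p`. -/
theorem lintegral_norm_deriv_ne_top_of_le_one {p α : ℝ} (hp : 0 < p) (hp1 : p ≤ 1) (hα : -1 < α)
    {f : ℂ → ℂ} (hf : MemDirichlet p α f) :
    ∫⁻ z, ENNReal.ofReal (‖deriv f z‖ * (1 - ‖z‖ ^ 2) ^ ((α + 2) / p - 2)) ∂areaMeasure ≠ ∞ := by
  have hdd := differentiableOn_deriv hf.1
  obtain ⟨C, hC, hpt⟩ := norm_rpow_mul_one_sub_rpow_le hp α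
  set W := ∫⁻ z, ENNReal.ofReal (‖deriv f z‖ ^ p * (1 - ‖z‖ ^ 2) ^ α) ∂areaMeasure with hW
  have hWfin : W ≠ ∞ := ne_top_of_le_ne_top (ENNReal.mul_ne_top ENNReal.ofReal_ne_top
    (ENNReal.rpow_ne_top_of_nonneg hp.le hf.2.ne)) (lintegral_deriv_le_dirichletNorm_rpow hp hα f)
  have hCW : C * W ≠ ∞ := ENNReal.mul_ne_top hC hWfin
  set M := (C * W).toReal with hM
  have hgrow (z : ℂ) (hz : z ∈ unitDisc) : ‖deriv f z‖ ^ p * (1 - ‖z‖) ^ (α + 2) ≤ M := by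
    have h1 := (hpt _ hdd z hz).trans (mul_le_mul' le_rfl (setLIntegral_le_lintegral _ _))
    exact (ENNReal.ofReal_le_iff_le_toReal hCW).1 h1
  set x := (α + 2) * ((1 - p) / p) with hx
  have hx0 : 0 ≤ (1 - p) / p := div_nonneg (by linarith) hp.le
  refine ne_top_of_le_ne_top (ENNReal.mul_ne_top
    (ENNReal.ofReal_ne_top (r := M ^ ((1 - p) / p) * 3 ^ |-x|)) hWfin) ?_
  rw [hW, ← lintegral_const_mul' _ _ ENNReal.ofReal_ne_top]
  refine lintegral_mono_ae ?_
  filter_upwards [ae_mem_unitDisc] with z hz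
  have hz1 := mem_unitDisc.1 hz
  have hz0 := norm_nonneg z
  have hu : 0 < 1 - ‖z‖ := by linarith
  have hu2 := one_sub_norm_sq_pos hz
  rw [← ENNReal.ofReal_mul (by positivity)]
  refine ENNReal.ofReal_le_ofReal ?_
  have h1 : ‖deriv f z‖ ≤ ‖deriv f z‖ ^ p * (M ^ ((1 - p) / p) * (1 - ‖z‖) ^ (-x)) := by
    rcases eq_or_lt_of_le (norm_nonneg (deriv f z)) with h0 | h0
    · rw [← h0, Real.zero_rpow hp.ne', zero_mul]
    · have h2 := Real.rpow_le_rpow (by positivity) (hgrow z hz) hx0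
      rw [Real.mul_rpow (by positivity) (by positivity), ← Real.rpow_mul h0.le,
        ← Real.rpow_mul hu.le, mul_div_cancel₀ _ hp.ne', ← hx] at h2
      rw [Real.rpow_neg hu.le, ← div_eq_mul_inv]
      calc ‖deriv f z‖ = ‖deriv f z‖ ^ p * ‖deriv f z‖ ^ (1 - p) := by
            rw [← Real.rpow_add h0, add_sub_cancel, Real.rpow_one]
        _ ≤ _ := by
            gcongr
            rwa [le_div_iff₀ (by positivity)]
  have h2 : (1 - ‖z‖) ^ (-x) ≤ 3 ^ |-x| * (1 - ‖z‖ ^ 2) ^ (-x) :=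
    rpow_le_three_rpow_mul _ hu (by nlinarith) (by nlinarith)
  calc _ ≤ ‖deriv f z‖ ^ p * (M ^ ((1 - p) / p) * (3 ^ |-x| * (1 - ‖z‖ ^ 2) ^ (-x))) *
        (1 - ‖z‖ ^ 2) ^ ((α + 2) / p - 2) := by
        gcongr
        exact h1.trans (by gcongr)
    _ = _ := by
        rw [show α = -x + ((α + 2) / p - 2) by rw [hx]; field_simp; ring, Real.rpow_add hu2]
        have hxx : -((-x + ((α + 2) / p - 2) + 2) * ((1 - p) / p)) = -x := by
          rw [hx]; field_simp; ring
        have hxy : ((-x + ((α + 2) / p - 2) + 2) / p - 2) = ((α + 2) / p - 2) := by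
          rw [hx]; field_simp; ring
        simp only [hxy]
        ring

/-- Young's inequality separates `|f'|^p (1-|z|²)^α` from a pure weight `(1-|z|²)^τ`; the lower
bound on `η` amounts to `τ > -1`. -/
theorem lintegral_norm_deriv_ne_top_of_one_lt {p α η : ℝ} (hp : 1 < p) (hα : -1 < α)
    (hη : (α + 1) / p - 1 < η) {f : ℂ → ℂ} (hf : MemDirichlet p α f) :
    ∫⁻ z, ENNReal.ofReal (‖deriv f z‖ * (1 - ‖z‖ ^ 2) ^ η) ∂areaMeasure ≠ ∞ := by
  have hp0 : 0 < p := by linarith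
  set W := ∫⁻ z, ENNReal.ofReal (‖deriv f z‖ ^ p * (1 - ‖z‖ ^ 2) ^ α) ∂areaMeasure with hW
  have hWfin : W ≠ ∞ := ne_top_of_le_ne_top (ENNReal.mul_ne_top ENNReal.ofReal_ne_top
    (ENNReal.rpow_ne_top_of_nonneg hp0.le hf.2.ne)) (lintegral_deriv_le_dirichletNorm_rpow hp0 hα f)
  have hpq : p.HolderConjugate (p / (p - 1)) := Real.HolderConjugate.conjExponent hp
  set r := p / (p - 1) with hr
  have hr0 : 0 < r := hpq.symm.pos
  set τ := (η - α / p) * r with hτ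
  have hτ1 : -1 < τ := by
    have h1 : (-(1 / r)) * r < τ := by
      refine mul_lt_mul_of_pos_right ?_ hr0
      have := hpq.inv_add_inv_eq_one
      rw [add_div, ← one_div, ← one_div] at *
      linarith
    rwa [neg_mul, one_div_mul_cancel hr0.ne'] at h1
  -- Only the value `t = 0` is used, where the kernel is `1`; `M = τ + 3` is an arbitrary admissible
  -- exponent.
  obtain ⟨C, hC, hint⟩ := lintegral_norm_one_sub_mul_rpow_le (a := τ) (M := τ + 3) hτ1 (by linarith)
  have hfin : ∫⁻ z, ENNReal.ofReal ((1 - ‖z‖ ^ 2) ^ τ) ∂areaMeasure ≠ ∞ := by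
    have := hint 0 le_rfl one_pos
    simp only [Complex.ofReal_zero, zero_mul, sub_zero, norm_one, Real.one_rpow, one_mul] at this
    exact ne_top_of_le_ne_top (by finiteness) this
  refine ne_top_of_le_ne_top (ENNReal.add_ne_top.2 ⟨hWfin, hfin⟩) ?_
  rw [hW, ← lintegral_add_right _ (by fun_prop)]
  refine lintegral_mono_ae ?_
  filter_upwards [ae_mem_unitDisc] with z hz
  have hu := one_sub_norm_sq_pos hz
  rw [← ENNReal.ofReal_add (by positivity) (by positivity)]
  refine ENNReal.ofReal_le_ofReal ?_
  have hy := Real.young_inequality_of_nonneg (a := ‖deriv f z‖ * (1 - ‖z‖ ^ 2) ^ (α / p))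
    (b := (1 - ‖z‖ ^ 2) ^ (η - α / p)) (by positivity) (by positivity) hpq
  rw [mul_assoc, ← Real.rpow_add hu, add_sub_cancel, Real.mul_rpow (by positivity) (by positivity),
    ← Real.rpow_mul hu.le, ← Real.rpow_mul hu.le, div_mul_cancel₀ _ hp0.ne', ← hτ] at hy
  refine hy.trans (add_le_add (div_le_self (by positivity) hp.le)
    (div_le_self (by positivity) hpq.symm.lt.le))

/-- Absolute convergence of the series defining the generalized Hilbert operator. -/
theorem MemDirichlet.summable_taylorCoeff_mul {p α s : ℝ} (hp : 0 < p) (hα : p - 1 < α)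
    (hs₁ : p ≤ 1 → (α + 2) / p - 1 < s) (hs₂ : 1 < p → (α + 1) / p < s)
    {μ : Measure (Ico (0 : ℝ) 1)} (hμ : IsCarleson s μ) {f : ℂ → ℂ} (hf : MemDirichlet p α f) :
    Summable fun k => ‖taylorCoeff f k‖ * ∫ t : Ico (0 : ℝ) 1, (t : ℝ) ^ k ∂μ := by
  rcases le_or_gt p 1 with h1 | h1
  · have h2 := hs₁ h1
    have h3 : 1 ≤ (α + 2) / p := by rw [one_le_div hp]; linarith
    exact summable_taylorCoeff_mul_integral_pow (by linarith) (η := (α + 2) / p - 2) (by linarith) hμ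
      hf.1 (lintegral_norm_deriv_ne_top_of_le_one hp h1 (by linarith) hf)
  · have h2 := hs₂ h1
    have h3 : 0 < (α + 1) / p := div_pos (by linarith) hp
    exact summable_taylorCoeff_mul_integral_pow (by linarith)
      (η := ((α + 1) / p + s) / 2 - 1) (by linarith) hμ hf.1
      (lintegral_norm_deriv_ne_top_of_one_lt h1 (by linarith) (by linarith) hf)

/-! ### Integral representation of the operator -/

theorem hasSum_of_eq {u v : ℕ → ℂ} {a b : ℂ} (h : HasSum v b) (huv : ∀ n, u n = v n)
    (hab : a = b) : HasSum u a := by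
  rw [hab, funext huv]
  exact h

theorem ascPochhammer_smeval_mul_Gamma {β : ℝ} (hβ : 0 < β) (n : ℕ) :
    (ascPochhammer ℕ n).smeval β * Real.Gamma β = Real.Gamma (n + β) := by
  induction n with
  | zero => simp
  | succ n ih =>
    rw [ascPochhammer_succ_right, Polynomial.smeval_mul, Polynomial.smeval_add, Polynomial.smeval_X,
      Polynomial.smeval_natCast, pow_one, pow_zero, nsmul_one, mul_right_comm, ih]
    push_cast
    rw [show (n : ℝ) + 1 + β = (n + β) + 1 by ring, Real.Gamma_add_one (by positivity)]
    ring

theorem choose_eq_Gamma_div {β : ℝ} (hβ : 0 < β) (n : ℕ) :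
    Ring.choose (β + n - 1) n = Real.Gamma (n + β) / (n.factorial * Real.Gamma β) := by
  have h := Ring.factorial_nsmul_multichoose_eq_ascPochhammer β n
  rw [nsmul_eq_mul] at h
  have hG := (Real.Gamma_pos_of_pos hβ).ne'
  have hn : (n.factorial : ℝ) ≠ 0 := by positivity
  rw [← ascPochhammer_smeval_mul_Gamma hβ, ← h, Ring.choose,
    show β + n - 1 - n + 1 = β by ring]
  field_simp

/-- The binomial series of `(1 - w) ^ (-β)`. -/
theorem hasSum_one_sub_cpow {β : ℝ} (hβ : 0 < β) {w : ℂ} (hw : ‖w‖ < 1) :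
    HasSum (fun n : ℕ => ((Real.Gamma (n + β) / (n.factorial * Real.Gamma β) : ℝ) : ℂ) * w ^ n)
      ((1 - w) ^ ((-β : ℝ) : ℂ)) := by
  have h := (Complex.one_div_one_sub_cpow_hasFPowerSeriesOnBall_zero (β : ℂ)).hasSum
    (y := w) (by simpa [← ofReal_norm, ENNReal.ofReal_lt_one] using hw)
  rw [zero_add, one_div, ← Complex.cpow_neg, ← Complex.ofReal_neg] at h
  refine hasSum_of_eq h (fun n => ?_) rfl
  rw [← choose_eq_Gamma_div hβ, Complex.ofReal_choose]
  simp [FormalMultilinearSeries.ofScalars]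

theorem hasSum_taylorCoeff {f : ℂ → ℂ} {r : ℝ} (hf : DifferentiableOn ℂ f (Metric.ball 0 r))
    {z : ℂ} (hz : z ∈ Metric.ball (0 : ℂ) r) :
    HasSum (fun k => taylorCoeff f k * z ^ k) (f z) := by
  refine hasSum_of_eq (Complex.hasSum_taylorSeries_on_ball hf hz) (fun k => ?_) rfl
  rw [taylorCoeff, sub_zero, smul_eq_mul, smul_eq_mul]
  ring

section

variable {μ : Measure (Ico (0 : ℝ) 1)} {f : ℂ → ℂ}

theorem integrable_pow [IsFiniteMeasure μ] (k : ℕ) : Integrable (fun t : Ico (0 : ℝ) 1 => (t : ℝ) ^ k) μ := by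
  refine Integrable.of_bound (by fun_prop) 1 (Filter.Eventually.of_forall fun t => ?_)
  rw [Real.norm_of_nonneg (pow_nonneg t.2.1 k)]
  exact pow_le_one₀ t.2.1 t.2.2.le

theorem integrable_of_summable [IsFiniteMeasure μ] (hf : DifferentiableOn ℂ f unitDisc)
    (hsum : Summable fun k => ‖taylorCoeff f k‖ * ∫ t : Ico (0 : ℝ) 1, (t : ℝ) ^ k ∂μ) :
    Integrable (fun t : Ico (0 : ℝ) 1 => f ((t : ℝ) : ℂ)) μ := by
  refine ⟨(continuous_comp_coe hf).aestronglyMeasurable, ?_⟩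
  rw [hasFiniteIntegral_iff_enorm]
  calc ∫⁻ t : Ico (0 : ℝ) 1, ‖f ((t : ℝ) : ℂ)‖ₑ ∂μ
      ≤ ∫⁻ t : Ico (0 : ℝ) 1, ∑' k, ENNReal.ofReal (‖taylorCoeff f k‖ * (t : ℝ) ^ k) ∂μ := by
        refine lintegral_mono fun t => ?_
        rw [← (hasSum_taylorCoeff hf (ofReal_mem_unitDisc t.2.1 t.2.2)).tsum_eq]
        refine enorm_tsum_le_tsum_enorm.trans_eq (tsum_congr fun k => ?_)
        rw [← ofReal_norm, norm_mul, norm_pow, Complex.norm_real, Real.norm_of_nonneg t.2.1]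
    _ = ∑' k, ENNReal.ofReal (‖taylorCoeff f k‖ * ∫ t : Ico (0 : ℝ) 1, (t : ℝ) ^ k ∂μ) := by
        rw [lintegral_tsum fun k => Measurable.aemeasurable (by fun_prop)]
        refine tsum_congr fun k => ?_
        rw [← integral_const_mul, ofReal_integral_eq_lintegral_ofReal ((integrable_pow k).const_mul _)]
        exact Filter.Eventually.of_forall fun t => mul_nonneg (norm_nonneg _) (pow_nonneg t.2.1 k)
    _ < ∞ := by
        rw [← ENNReal.ofReal_tsum_of_nonneg (fun k => mul_nonneg (norm_nonneg _)
          (integral_nonneg fun t => pow_nonneg t.2.1 _)) hsum]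
        exact ENNReal.ofReal_lt_top

/-- The exchange of sum and integral is dominated by the summability hypothesis, since the extra
factor `t^n` is at most `1`. -/
theorem hasSum_hankelEntry_mul_taylorCoeff [IsFiniteMeasure μ] (hf : DifferentiableOn ℂ f unitDisc)
    (hsum : Summable fun k => ‖taylorCoeff f k‖ * ∫ t : Ico (0 : ℝ) 1, (t : ℝ) ^ k ∂μ)
    (β : ℝ) (n : ℕ) :
    HasSum (fun k => (hankelEntry μ β n k : ℂ) * taylorCoeff f k)
      (((Real.Gamma (n + β) / (n.factorial * Real.Gamma β) : ℝ) : ℂ) *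
        ∫ t : Ico (0 : ℝ) 1, ((t : ℝ) : ℂ) ^ n * f ((t : ℝ) : ℂ) ∂μ) := by
  set F : ℕ → Ico (0 : ℝ) 1 → ℂ := fun k t => (((t : ℝ) ^ (n + k) : ℝ) : ℂ) * taylorCoeff f k with hF
  have hnorm (k : ℕ) (t : Ico (0 : ℝ) 1) : ‖F k t‖ = ‖taylorCoeff f k‖ * (t : ℝ) ^ (n + k) := by
    rw [hF, norm_mul, Complex.norm_real, Real.norm_of_nonneg (pow_nonneg t.2.1 _), mul_comm]
  have h := hasSum_integral_of_summable_integral_norm (μ := μ) (F := F)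
    (fun k => ((integrable_pow (n + k)).ofReal).mul_const _) (by
      refine Summable.of_nonneg_of_le (fun k => integral_nonneg fun t => norm_nonneg _)
        (fun k => ?_) hsum
      simp_rw [hnorm]
      rw [integral_const_mul]
      refine mul_le_mul_of_nonneg_left ?_ (norm_nonneg _)
      refine integral_mono (integrable_pow _) (integrable_pow _) fun t => ?_
      exact pow_le_pow_of_le_one t.2.1 t.2.2.le (Nat.le_add_left k n))
  refine hasSum_of_eq (h.mul_left ((Real.Gamma (n + β) / (n.factorial * Real.Gamma β) : ℝ) : ℂ))
    (fun k => ?_) (congrArg _ (congrArg _ (funext fun t => ?_)))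
  · rw [hF, hankelEntry, integral_const_mul, integral_mul_const, integral_complex_ofReal]
    push_cast
    ring
  · have := (hasSum_taylorCoeff hf (ofReal_mem_unitDisc t.2.1 t.2.2)).mul_left (((t : ℝ) : ℂ) ^ n)
    rw [← this.tsum_eq]
    refine tsum_congr fun k => ?_
    rw [hF]
    push_cast
    ring

theorem norm_mul_lt_one (t : Ico (0 : ℝ) 1) {z : ℂ} (hz : z ∈ unitDisc) :
    ‖((t : ℝ) : ℂ) * z‖ < 1 := by
  rw [norm_mul, Complex.norm_real, Real.norm_of_nonneg t.2.1]
  have := mem_unitDisc.1 hz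
  nlinarith [t.2.1, t.2.2, norm_nonneg z]

theorem one_sub_mul_mem_slitPlane (t : Ico (0 : ℝ) 1) {z : ℂ} (hz : z ∈ unitDisc) :
    1 - ((t : ℝ) : ℂ) * z ∈ Complex.slitPlane := by
  rw [sub_eq_add_neg]
  exact Complex.mem_slitPlane_of_norm_lt_one (by rw [norm_neg]; exact norm_mul_lt_one t hz)

theorem continuous_one_sub_mul_cpow {z : ℂ} (hz : z ∈ unitDisc) (c : ℂ) :
    Continuous fun t : Ico (0 : ℝ) 1 => (1 - ((t : ℝ) : ℂ) * z) ^ c :=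
  Continuous.cpow (by fun_prop) continuous_const fun t => one_sub_mul_mem_slitPlane t hz

theorem hasSum_moments_mul_pow {β : ℝ} (hβ : 0 < β)
    (hfi : Integrable (fun t : Ico (0 : ℝ) 1 => f ((t : ℝ) : ℂ)) μ) {z : ℂ} (hz : z ∈ unitDisc) :
    HasSum (fun n : ℕ => ((Real.Gamma (n + β) / (n.factorial * Real.Gamma β) : ℝ) : ℂ) *
        (∫ t : Ico (0 : ℝ) 1, ((t : ℝ) : ℂ) ^ n * f ((t : ℝ) : ℂ) ∂μ) * z ^ n)
      (∫ t : Ico (0 : ℝ) 1, f ((t : ℝ) : ℂ) * (1 - ((t : ℝ) : ℂ) * z) ^ ((-β : ℝ) : ℂ) ∂μ) := by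
  set γ : ℕ → ℝ := fun n => Real.Gamma (n + β) / (n.factorial * Real.Gamma β) with hγ
  set F : ℕ → Ico (0 : ℝ) 1 → ℂ := fun n t =>
    ((γ n : ℂ) * z ^ n) * (((t : ℝ) : ℂ) ^ n * f ((t : ℝ) : ℂ)) with hF
  have hle (n : ℕ) (t : Ico (0 : ℝ) 1) :
      ‖((t : ℝ) : ℂ) ^ n * f ((t : ℝ) : ℂ)‖ ≤ ‖f ((t : ℝ) : ℂ)‖ := by
    rw [norm_mul, norm_pow, Complex.norm_real, Real.norm_of_nonneg t.2.1]
    exact mul_le_of_le_one_left (norm_nonneg _) (pow_le_one₀ t.2.1 t.2.2.le)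
  have hint (n : ℕ) : Integrable
      (fun t : Ico (0 : ℝ) 1 => ((t : ℝ) : ℂ) ^ n * f ((t : ℝ) : ℂ)) μ := by
    refine hfi.mono (AEStronglyMeasurable.mul ?_ hfi.1) (Filter.Eventually.of_forall (hle n))
    exact Continuous.aestronglyMeasurable (by fun_prop)
  have hγsum : Summable fun n => ‖(γ n : ℂ) * z ^ n‖ :=
    (hasSum_one_sub_cpow hβ (mem_unitDisc.1 hz)).summable.norm
  have h := hasSum_integral_of_summable_integral_norm (μ := μ) (F := F)
    (fun n => (hint n).const_mul _) (by
      refine Summable.of_nonneg_of_le (fun n => integral_nonneg fun t => norm_nonneg _) (fun n => ?_)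
        (hγsum.mul_right (∫ t : Ico (0 : ℝ) 1, ‖f ((t : ℝ) : ℂ)‖ ∂μ))
      rw [← integral_const_mul]
      refine integral_mono ((hint n).const_mul _).norm (hfi.norm.const_mul _) fun t => ?_
      simp only [hF, norm_mul ((γ n : ℂ) * z ^ n)]
      exact mul_le_mul_of_nonneg_left (hle n t) (norm_nonneg _))
  refine hasSum_of_eq h (fun n => ?_) (congrArg _ (funext fun t => ?_))
  · rw [hF, integral_const_mul]
    ring
  · have := (hasSum_one_sub_cpow hβ (norm_mul_lt_one t hz)).mul_left (f ((t : ℝ) : ℂ))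
    rw [← this.tsum_eq]
    refine tsum_congr fun n => ?_
    rw [hF, mul_pow]
    ring

theorem isHilbertImage_integral [IsFiniteMeasure μ] {β : ℝ} (hβ : 0 < β) (hf : DifferentiableOn ℂ f unitDisc)
    (hsum : Summable fun k => ‖taylorCoeff f k‖ * ∫ t : Ico (0 : ℝ) 1, (t : ℝ) ^ k ∂μ) :
    IsHilbertImage μ β f fun z =>
      ∫ t : Ico (0 : ℝ) 1, f ((t : ℝ) : ℂ) * (1 - ((t : ℝ) : ℂ) * z) ^ ((-β : ℝ) : ℂ) ∂μ :=
  ⟨_, fun n => (hasSum_hankelEntry_mul_taylorCoeff hf hsum β n).tendsto_sum_nat,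
    fun _ hz => hasSum_moments_mul_pow hβ (integrable_of_summable hf hsum) hz⟩

/-- Uniqueness of limits. Boundedness only provides some image `g`; this identifies it with the
integral on the disc, so that its derivative can be computed. -/
theorem IsHilbertImage.eq_integral [IsFiniteMeasure μ] {β : ℝ} (hβ : 0 < β) (hf : DifferentiableOn ℂ f unitDisc)
    (hsum : Summable fun k => ‖taylorCoeff f k‖ * ∫ t : Ico (0 : ℝ) 1, (t : ℝ) ^ k ∂μ)
    {g : ℂ → ℂ} (hg : IsHilbertImage μ β f g) {z : ℂ} (hz : z ∈ unitDisc) :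
    g z = ∫ t : Ico (0 : ℝ) 1, f ((t : ℝ) : ℂ) * (1 - ((t : ℝ) : ℂ) * z) ^ ((-β : ℝ) : ℂ) ∂μ := by
  obtain ⟨c, hc, hgc⟩ := hg
  have hc' (n : ℕ) := tendsto_nhds_unique (hc n)
    (hasSum_hankelEntry_mul_taylorCoeff hf hsum β n).tendsto_sum_nat
  have h := hgc z hz
  simp_rw [hc'] at h
  exact h.unique (hasSum_moments_mul_pow hβ (integrable_of_summable hf hsum) hz)

theorem norm_one_sub_mul_cpow_le (t : Ico (0 : ℝ) 1) {z : ℂ} (hz : z ∈ unitDisc) {c : ℝ}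
    (hc : 0 ≤ c) : ‖(1 - ((t : ℝ) : ℂ) * z) ^ ((-c : ℝ) : ℂ)‖ ≤ (1 - ‖z‖) ^ (-c) := by
  have hz1 := mem_unitDisc.1 hz
  rw [Complex.norm_cpow_real]
  refine Real.rpow_le_rpow_of_nonpos (by linarith) ?_ (by linarith)
  have h1 := norm_sub_norm_le 1 (((t : ℝ) : ℂ) * z)
  rw [norm_one, norm_mul, Complex.norm_real, Real.norm_of_nonneg t.2.1] at h1
  nlinarith [norm_nonneg z, t.2.2]

theorem hasDerivAt_integral_kernel {β : ℝ} (hβ : 0 < β)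
    (hfi : Integrable (fun t : Ico (0 : ℝ) 1 => f ((t : ℝ) : ℂ)) μ) {z : ℂ} (hz : z ∈ unitDisc) :
    HasDerivAt (fun z => ∫ t : Ico (0 : ℝ) 1,
        f ((t : ℝ) : ℂ) * (1 - ((t : ℝ) : ℂ) * z) ^ ((-β : ℝ) : ℂ) ∂μ)
      (∫ t : Ico (0 : ℝ) 1, f ((t : ℝ) : ℂ) *
        (β * ((t : ℝ) : ℂ) * (1 - ((t : ℝ) : ℂ) * z) ^ ((-(β + 1) : ℝ) : ℂ)) ∂μ) z := by
  have hz1 := mem_unitDisc.1 hz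
  set ρ := (1 - ‖z‖) / 2 with hρ
  have hρ0 : 0 < ρ := by rw [hρ]; linarith
  have hball : ∀ w ∈ Metric.ball z ρ, w ∈ unitDisc ∧ ρ ≤ 1 - ‖w‖ := fun w hw => by
    rw [mem_ball_iff_norm] at hw
    have := norm_sub_norm_le w z
    rw [mem_unitDisc]
    constructor <;> linarith
  refine (hasDerivAt_integral_of_dominated_loc_of_deriv_le (Metric.ball_mem_nhds z hρ0)
    (F := fun w (t : Ico (0 : ℝ) 1) =>
      f ((t : ℝ) : ℂ) * (1 - ((t : ℝ) : ℂ) * w) ^ ((-β : ℝ) : ℂ))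
    (F' := fun w (t : Ico (0 : ℝ) 1) => f ((t : ℝ) : ℂ) *
      (β * ((t : ℝ) : ℂ) * (1 - ((t : ℝ) : ℂ) * w) ^ ((-(β + 1) : ℝ) : ℂ)))
    (bound := fun t : Ico (0 : ℝ) 1 => ‖f ((t : ℝ) : ℂ)‖ * (β * ρ ^ (-(β + 1)))) ?_ ?_ ?_ ?_ ?_ ?_).2
  · filter_upwards [Metric.ball_mem_nhds z hρ0] with w hw
    exact hfi.1.mul (continuous_one_sub_mul_cpow (hball w hw).1 _).aestronglyMeasurable
  · refine hfi.mul_bdd (c := (1 - ‖z‖) ^ (-β))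
      (continuous_one_sub_mul_cpow hz _).aestronglyMeasurable
      (Filter.Eventually.of_forall fun t => norm_one_sub_mul_cpow_le t hz hβ.le)
  · refine hfi.1.mul (Continuous.aestronglyMeasurable ?_)
    exact Continuous.mul (by fun_prop) (continuous_one_sub_mul_cpow hz _)
  · refine Filter.Eventually.of_forall fun t w hw => ?_
    obtain ⟨hwD, hwρ⟩ := hball w hw
    rw [norm_mul, norm_mul, norm_mul, Complex.norm_real, Complex.norm_real,
      Real.norm_of_nonneg hβ.le, Real.norm_of_nonneg t.2.1]
    refine mul_le_mul_of_nonneg_left ?_ (norm_nonneg _)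
    refine mul_le_mul (mul_le_of_le_one_right hβ.le t.2.2.le) ?_ (norm_nonneg _) hβ.le
    exact (norm_one_sub_mul_cpow_le t hwD (by linarith)).trans
      (Real.rpow_le_rpow_of_nonpos hρ0 hwρ (by linarith))
  · exact hfi.norm.mul_const _
  · refine Filter.Eventually.of_forall fun t w hw => ?_
    have h1 : HasDerivAt (fun w : ℂ => 1 - ((t : ℝ) : ℂ) * w) (-((t : ℝ) : ℂ)) w := by
      simpa using ((hasDerivAt_id w).const_mul ((t : ℝ) : ℂ)).const_sub 1
    have h2 := (h1.cpow_const (c := ((-β : ℝ) : ℂ))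
      (one_sub_mul_mem_slitPlane t (hball w hw).1)).const_mul (f ((t : ℝ) : ℂ))
    refine h2.congr_deriv ?_
    rw [show ((-(β + 1) : ℝ) : ℂ) = ((-β : ℝ) : ℂ) - 1 by push_cast; ring]
    push_cast
    ring

end

/-! ### Sufficiency -/

theorem hilbertBounded_of_isCarleson {p q q' α β : ℝ} (hqq : q.HolderConjugate q') (hp : 0 < p)
    (hpq : p ≤ q) (hα : p - 1 < α) (hβ : 0 < β) {μ : Measure (Ico (0 : ℝ) 1)}
    (hμ : IsCarleson (max (α + 2 - p) (β + 1) * (1 / p + 1 / q')) μ) :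
    HilbertBounded μ β p α q (β - 1) := by
  have := hμ.isFiniteMeasure
  have hq0 := hqq.pos
  have hq'0 := hqq.symm.pos
  have hconj := hqq.inv_add_inv_eq_one
  -- This `P` makes the embedding order `P(α+2-p)/p` and the kernel order `Q(β+1)/q'` carry the same
  -- factor `1/p + 1/q'`, and satisfies `p ≤ P ≤ q`.
  set P := 1 + p / q' with hP
  set Q := 1 + q' / p with hQ
  have hP0 : 0 < P := by positivity
  have hQ0 : 0 < Q := by positivity
  have hPQ : P.HolderConjugate Q := by
    refine Real.holderConjugate_iff.2 ⟨?_, ?_⟩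
    · have : 0 < p / q' := by positivity
      linarith
    · rw [hP, hQ]
      field_simp
      ring
  have hq'inv : p / q' = p - p / q := by
    rw [div_eq_mul_inv, div_eq_mul_inv]
    linear_combination p * hconj
  have hpP : p ≤ P := by
    have : p / q ≤ 1 := (div_le_one hq0).2 hpq
    linarith
  have hPq : P ≤ q := by
    have h1 : p / q' ≤ q / q' := by gcongr
    have h2 : q / q' = q - 1 := by
      rw [div_eq_mul_inv]
      have : q * q⁻¹ = 1 := mul_inv_cancel₀ hq0.ne'
      linear_combination q * hconj - this
    linarith
  have hsum0 : 0 < 1 / p + 1 / q' := by positivity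
  have hμ₁ : IsCarleson (P * ((α + 2 - p) / p)) μ := hμ.mono (by
    rw [show P * ((α + 2 - p) / p) = (α + 2 - p) * (1 / p + 1 / q') by rw [hP]; field_simp]
    exact mul_le_mul_of_nonneg_right (le_max_left _ _) hsum0.le)
  have hμ₂ : IsCarleson (Q * ((β + 1) / q')) μ := hμ.mono (by
    rw [show Q * ((β + 1) / q') = (β + 1) * (1 / p + 1 / q') by rw [hQ]; field_simp; ring]
    exact mul_le_mul_of_nonneg_right (le_max_right _ _) hsum0.le)
  have hx1 : 1 < α + 2 - p := by linarith
  have hexp : P * ((α + 2 - p) / p) = (α + 2 - p) / p + (α + 2 - p) / q' := by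
    rw [hP]; field_simp
  -- For `p > 1` the order exceeds `(α+1)/p` because `α + 2 - p > 1` and `1/q' = 1 - 1/q ≥ 1 - 1/p`.
  have hsummable {f : ℂ → ℂ} (hf : MemDirichlet p α f) :=
    hf.summable_taylorCoeff_mul hp hα (s := P * ((α + 2 - p) / p))
      (fun _ => by
        have h1 : (α + 2 - p) / p = (α + 2) / p - 1 := by field_simp
        have h2 : 0 < (α + 2 - p) / q' := by positivity
        linarith)
      (fun h1p => by
        have h1 : (α + 1) / p = (α + 2 - p) / p + (1 - 1 / p) := by field_simp; ring
        have h2 : 1 / q' < (α + 2 - p) / q' := by gcongr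
        have h3 : q⁻¹ ≤ p⁻¹ := inv_anti₀ hp hpq
        rw [one_div] at h1 h2
        linarith) hμ₁
  obtain ⟨C₁, hC₁, hemb⟩ := lintegral_norm_rpow_le_dirichletNorm hp hα hpP hμ₁
  obtain ⟨C₂, hC₂, hker⟩ := lintegral_kernel_rpow_le hPQ hqq hPq hβ hμ₂
  set K : ℝ≥0∞ := (μ univ ^ (1 / Q) +
    (ENNReal.ofReal β * ENNReal.ofReal β ^ q * C₂) ^ (1 / q)) * C₁ ^ (1 / P) with hK
  have hKfin : K ≠ ∞ := by
    refine ENNReal.mul_ne_top (ENNReal.add_ne_top.2 ⟨?_, ?_⟩)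
      (ENNReal.rpow_ne_top_of_nonneg (by positivity) hC₁)
    · exact ENNReal.rpow_ne_top_of_nonneg (by positivity) (measure_ne_top _ _)
    · refine ENNReal.rpow_ne_top_of_nonneg (by positivity) (ENNReal.mul_ne_top
        (ENNReal.mul_ne_top ENNReal.ofReal_ne_top ?_) hC₂)
      exact ENNReal.rpow_ne_top_of_nonneg hq0.le ENNReal.ofReal_ne_top
  refine ⟨K.toNNReal, fun f hf => ?_⟩
  rw [ENNReal.coe_toNNReal hKfin]
  have hfi := integrable_of_summable hf.1 (hsummable hf)
  set g : ℂ → ℂ := fun z =>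
    ∫ t : Ico (0 : ℝ) 1, f ((t : ℝ) : ℂ) * (1 - ((t : ℝ) : ℂ) * z) ^ ((-β : ℝ) : ℂ) ∂μ with hg
  set φ : Ico (0 : ℝ) 1 → ℝ≥0∞ := fun t => ENNReal.ofReal ‖f ((t : ℝ) : ℂ)‖ with hφ
  have hφm : Measurable φ :=
    ENNReal.measurable_ofReal.comp (continuous_comp_coe hf.1).norm.measurable
  set X := ∫⁻ t, φ t ^ P ∂μ with hX
  have hXle : X ≤ C₁ * dirichletNorm p α f ^ P := by
    refine le_trans (le_of_eq (lintegral_congr fun t => ?_)) (hemb f hf.1)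
    rw [hφ, ENNReal.ofReal_rpow_of_nonneg (norm_nonneg _) hP0.le]
  have hXfin : X ≠ ∞ := ne_top_of_le_ne_top
    (ENNReal.mul_ne_top hC₁ (ENNReal.rpow_ne_top_of_nonneg hP0.le hf.2.ne)) hXle
  have hXP : X ^ (1 / P) ≤ C₁ ^ (1 / P) * dirichletNorm p α f := by
    refine (ENNReal.rpow_le_rpow hXle (by positivity)).trans_eq ?_
    rw [ENNReal.mul_rpow_of_nonneg _ _ (by positivity), ← ENNReal.rpow_mul,
      mul_one_div_cancel hP0.ne', ENNReal.rpow_one]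
  have hg0 : ENNReal.ofReal ‖g 0‖ ≤ μ univ ^ (1 / Q) * X ^ (1 / P) := by
    calc ENNReal.ofReal ‖g 0‖ ≤ ∫⁻ t, φ t ∂μ := by
          rw [ofReal_norm]
          refine (enorm_integral_le_lintegral_enorm _).trans_eq (lintegral_congr fun t => ?_)
          rw [mul_zero, sub_zero, Complex.one_cpow, mul_one]
          exact (ofReal_norm _).symm
      _ = ∫⁻ t, (φ * (fun _ => 1 : Ico (0 : ℝ) 1 → ℝ≥0∞)) t ∂μ := by simp
      _ ≤ X ^ (1 / P) * (∫⁻ _, 1 ^ Q ∂μ) ^ (1 / Q) :=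
          ENNReal.lintegral_mul_le_Lp_mul_Lq μ hPQ hφm.aemeasurable aemeasurable_const
      _ = _ := by rw [ENNReal.one_rpow, lintegral_one, mul_comm]
  have hgd (z : ℂ) (hz : z ∈ unitDisc) := hasDerivAt_integral_kernel (f := f) hβ hfi hz
  have hgderiv (z : ℂ) (hz : z ∈ unitDisc) : ENNReal.ofReal ‖deriv g z‖ ≤ ENNReal.ofReal β *
      ∫⁻ t, φ t * ENNReal.ofReal (‖1 - ((t : ℝ) : ℂ) * z‖ ^ (-(β + 1))) ∂μ := by
    rw [(hgd z hz).deriv, ofReal_norm, ← lintegral_const_mul' _ _ ENNReal.ofReal_ne_top]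
    refine (enorm_integral_le_lintegral_enorm _).trans (lintegral_mono fun t => ?_)
    rw [← ofReal_norm, norm_mul, norm_mul, norm_mul, Complex.norm_cpow_real, Complex.norm_real,
      Complex.norm_real, Real.norm_of_nonneg hβ.le, Real.norm_of_nonneg t.2.1, hφ,
      ← ENNReal.ofReal_mul (norm_nonneg _), ← ENNReal.ofReal_mul hβ.le]
    refine ENNReal.ofReal_le_ofReal ?_
    have hβt : β * (t : ℝ) ≤ β := mul_le_of_le_one_right hβ.le t.2.2.le
    refine (le_of_eq (by ring)).trans (mul_le_mul_of_nonneg_right hβt (by positivity))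
  have hberg : bergmanNorm q (β - 1) (deriv g) ≤
      (ENNReal.ofReal β * ENNReal.ofReal β ^ q * C₂) ^ (1 / q) * X ^ (1 / P) := by
    have h1 : ∫⁻ z, ENNReal.ofReal (‖deriv g z‖ ^ q * (1 - ‖z‖ ^ 2) ^ (β - 1)) ∂areaMeasure ≤
        ENNReal.ofReal β ^ q * (C₂ * X ^ (q / P)) := by
      refine le_trans ?_ (mul_le_mul' le_rfl (hker φ hφm hXfin))
      rw [← lintegral_const_mul' _ _ (ENNReal.rpow_ne_top_of_nonneg hq0.le ENNReal.ofReal_ne_top)]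
      refine lintegral_mono_ae ?_
      filter_upwards [ae_mem_unitDisc] with z hz
      rw [ENNReal.ofReal_mul (by positivity), ← mul_assoc, ← ENNReal.mul_rpow_of_nonneg _ _ hq0.le,
        ← ENNReal.ofReal_rpow_of_nonneg (norm_nonneg _) hq0.le]
      exact mul_le_mul' (ENNReal.rpow_le_rpow (hgderiv z hz) hq0.le) le_rfl
    rw [bergmanNorm, sub_add_cancel]
    refine (ENNReal.rpow_le_rpow (mul_le_mul' le_rfl h1) (by positivity)).trans_eq ?_
    rw [← mul_assoc, ← mul_assoc, ENNReal.mul_rpow_of_nonneg _ _ (by positivity),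
      ← ENNReal.rpow_mul, show q / P * (1 / q) = 1 / P by field_simp]
  have hnorm : dirichletNorm q (β - 1) g ≤ K * dirichletNorm p α f := by
    calc dirichletNorm q (β - 1) g ≤ μ univ ^ (1 / Q) * X ^ (1 / P) +
          (ENNReal.ofReal β * ENNReal.ofReal β ^ q * C₂) ^ (1 / q) * X ^ (1 / P) :=
          add_le_add hg0 hberg
      _ ≤ _ := by
          rw [← add_mul, hK, mul_assoc _ (C₁ ^ (1 / P))]
          exact mul_le_mul' le_rfl hXP
  refine ⟨g, isHilbertImage_integral hβ hf.1 (hsummable hf), ⟨fun z hz => ?_, ?_⟩, hnorm⟩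
  · exact (hgd z hz).differentiableAt.differentiableWithinAt
  · exact hnorm.trans_lt (ENNReal.mul_lt_top hKfin.lt_top hf.2)

/-! ### Test functions and necessity -/

section TestFunction

variable {b : ℝ}

theorem one_sub_mul_ne_zero (hb0 : 0 < b) {z : ℂ} (hz : z ∈ Metric.ball (0 : ℂ) (1 / b)) :
    1 - (b : ℂ) * z ≠ 0 := by
  intro h
  rw [mem_ball_zero_iff, lt_div_iff₀ hb0] at hz
  have h1 : (b : ℂ) * z = 1 := (sub_eq_zero.1 h).symm
  have h2 := congrArg norm h1
  rw [norm_mul, Complex.norm_real, Real.norm_of_nonneg hb0.le, norm_one] at h2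
  linarith

theorem unitDisc_subset_ball (hb0 : 0 < b) (hb1 : b < 1) :
    unitDisc ⊆ Metric.ball (0 : ℂ) (1 / b) :=
  Metric.ball_subset_ball (by rw [le_div_iff₀ hb0]; linarith)

theorem hasDerivAt_testFunction (m : ℕ) (hb0 : 0 < b) {z : ℂ}
    (hz : z ∈ Metric.ball (0 : ℂ) (1 / b)) :
    HasDerivAt (fun z : ℂ => ((1 - (b : ℂ) * z) ^ m)⁻¹)
      (m * b * ((1 - (b : ℂ) * z) ^ (m + 1))⁻¹) z := by
  have hne := one_sub_mul_ne_zero hb0 hz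
  have h1 : HasDerivAt (fun w : ℂ => 1 - (b : ℂ) * w) (-(b : ℂ)) z := by
    simpa using ((hasDerivAt_id z).const_mul (b : ℂ)).const_sub 1
  refine ((h1.pow m).inv (pow_ne_zero m hne)).congr_deriv ?_
  rcases m with _ | m
  · simp
  · rw [Nat.add_sub_cancel, Pi.pow_apply]
    field_simp
    ring

theorem differentiableOn_testFunction (m : ℕ) (hb0 : 0 < b) :
    DifferentiableOn ℂ (fun z : ℂ => ((1 - (b : ℂ) * z) ^ m)⁻¹) (Metric.ball (0 : ℂ) (1 / b)) :=
  fun _ hz => (hasDerivAt_testFunction m hb0 hz).differentiableAt.differentiableWithinAt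

/-- The derivative is `m b (1 - b z)^(-(m+1))`, so this is the Forelli–Rudin estimate with exponent
`(m+1)p`. The term `|f(0)| = 1` is absorbed because the exponent of `1 - b` is nonpositive. -/
theorem dirichletNorm_testFunction_le {p α : ℝ} (hp : 0 < p) (hα : -1 < α) {m : ℕ}
    (hm : α + 2 < (m + 1) * p) :
    ∃ C : ℝ≥0∞, C ≠ ∞ ∧ ∀ b : ℝ, 0 < b → b < 1 →
      dirichletNorm p α (fun z : ℂ => ((1 - (b : ℂ) * z) ^ m)⁻¹) ≤
        C * ENNReal.ofReal ((1 - b) ^ ((α + 2) / p - (m + 1))) := by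
  obtain ⟨C, hC, hint⟩ := lintegral_norm_one_sub_mul_rpow_le hα hm
  have hα1 : 0 < α + 1 := by linarith
  refine ⟨1 + (ENNReal.ofReal ((α + 1) * (m : ℝ) ^ p) * C) ^ (1 / p), ?_, fun b hb0 hb1 => ?_⟩
  · exact ENNReal.add_ne_top.2 ⟨ENNReal.one_ne_top, ENNReal.rpow_ne_top_of_nonneg (by positivity)
      (ENNReal.mul_ne_top ENNReal.ofReal_ne_top hC)⟩
  have hu : 0 < 1 - b := by linarith
  rw [add_mul, one_mul]
  refine add_le_add ?_ ?_
  · refine ENNReal.ofReal_le_ofReal ?_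
    simp only [mul_zero, sub_zero, one_pow, inv_one, norm_one]
    refine Real.one_le_rpow_of_pos_of_le_one_of_nonpos hu (by linarith) ?_
    rw [sub_nonpos, div_le_iff₀ hp]
    exact hm.le
  · have h1 : ∫⁻ z, ENNReal.ofReal (‖deriv (fun z : ℂ => ((1 - (b : ℂ) * z) ^ m)⁻¹) z‖ ^ p *
        (1 - ‖z‖ ^ 2) ^ α) ∂areaMeasure ≤
        ENNReal.ofReal ((m : ℝ) ^ p) * (C * ENNReal.ofReal ((1 - b) ^ (α + 2 - (m + 1) * p))) := by
      refine le_trans ?_ (mul_le_mul' le_rfl (hint b hb0.le hb1))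
      rw [← lintegral_const_mul' _ _ ENNReal.ofReal_ne_top]
      refine lintegral_mono_ae ?_
      filter_upwards [ae_mem_unitDisc] with z hz
      have hz0 := one_sub_norm_sq_pos hz
      have hzb := unitDisc_subset_ball hb0 hb1 hz
      have hn : 0 < ‖1 - (b : ℂ) * z‖ := norm_pos_iff.2 (one_sub_mul_ne_zero hb0 hzb)
      rw [← ENNReal.ofReal_mul (by positivity), ← mul_assoc]
      refine ENNReal.ofReal_le_ofReal (mul_le_mul_of_nonneg_right ?_ (by positivity))
      rw [(hasDerivAt_testFunction m hb0 hzb).deriv, norm_mul, norm_mul, norm_inv, norm_pow,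
        Complex.norm_natCast, Complex.norm_real, Real.norm_of_nonneg hb0.le,
        Real.mul_rpow (by positivity) (by positivity), Real.inv_rpow (by positivity),
        ← Real.rpow_natCast, ← Real.rpow_mul hn.le, ← Real.rpow_neg hn.le]
      push_cast
      refine mul_le_mul_of_nonneg_right ?_ (by positivity)
      exact Real.rpow_le_rpow (by positivity)
        (mul_le_of_le_one_right (Nat.cast_nonneg m) hb1.le) hp.le
    rw [bergmanNorm]
    refine (ENNReal.rpow_le_rpow (mul_le_mul' le_rfl h1) (by positivity)).trans_eq ?_
    rw [← mul_assoc, ← mul_assoc, ← ENNReal.ofReal_mul hα1.le,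
      ENNReal.mul_rpow_of_nonneg _ _ (by positivity), ENNReal.ofReal_rpow_of_pos (by positivity),
      ← Real.rpow_mul hu.le]
    congr 3
    field_simp

/-- Analyticity in the disc of radius `1/b > 1` makes the Taylor series converge absolutely at `1`,
so finiteness of `μ` is enough. -/
theorem summable_taylorCoeff_testFunction (m : ℕ) (hb0 : 0 < b) (hb1 : b < 1)
    (μ : Measure (Ico (0 : ℝ) 1)) [IsFiniteMeasure μ] :
    Summable fun k => ‖taylorCoeff (fun z : ℂ => ((1 - (b : ℂ) * z) ^ m)⁻¹) k‖ *
      ∫ t : Ico (0 : ℝ) 1, (t : ℝ) ^ k ∂μ := by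
  have h := (hasSum_taylorCoeff (differentiableOn_testFunction m hb0) (z := 1) (by
    rw [mem_ball_zero_iff, norm_one, lt_div_iff₀ hb0]; linarith)).summable.norm
  simp only [one_pow, mul_one] at h
  refine Summable.of_nonneg_of_le (fun k => mul_nonneg (norm_nonneg _)
    (integral_nonneg fun t => pow_nonneg t.2.1 _)) (fun k => ?_)
    (h.mul_right (∫ _ : Ico (0 : ℝ) 1, (1 : ℝ) ∂μ))
  refine mul_le_mul_of_nonneg_left ?_ (norm_nonneg _)
  exact integral_mono (integrable_pow k) (integrable_const _) fun t => pow_le_one₀ t.2.1 t.2.2.le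

/-- At `z = b` the integrand of `g'` is real and nonnegative, so there is no cancellation and it may
be restricted to `t ≥ b`. There `t ≥ 1/2` and `1 - b t ≤ 2(1 - b)`. -/
theorem measure_mul_le_norm_deriv (m : ℕ) (hb0 : 1 / 2 ≤ b) (hb1 : b < 1) {β : ℝ} (hβ : 0 < β)
    {μ : Measure (Ico (0 : ℝ) 1)} [IsFiniteMeasure μ] {g : ℂ → ℂ}
    (hg : IsHilbertImage μ β (fun z : ℂ => ((1 - (b : ℂ) * z) ^ m)⁻¹) g) :
    ENNReal.ofReal (β / 2 * (2 * (1 - b)) ^ (-((m : ℝ) + β + 1))) *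
      μ {t : Ico (0 : ℝ) 1 | b ≤ (t : ℝ)} ≤ ENNReal.ofReal ‖deriv g b‖ := by
  have hb : 0 < b := by linarith
  have hu : 0 < 1 - b := by linarith
  have hbD : (b : ℂ) ∈ unitDisc := ofReal_mem_unitDisc hb.le hb1
  have hf := (differentiableOn_testFunction m hb).mono (unitDisc_subset_ball hb hb1)
  have hsum := summable_taylorCoeff_testFunction m hb hb1 μ
  have hfi := integrable_of_summable hf hsum
  have hderiv : deriv g b = _ :=
    ((hasDerivAt_integral_kernel (f := fun z : ℂ => ((1 - (b : ℂ) * z) ^ m)⁻¹) hβ hfi hbD).congr_of_eventuallyEq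
      (Filter.eventually_of_mem (isOpen_unitDisc.mem_nhds hbD)
        fun z hz => hg.eq_integral hβ hf hsum hz)).deriv
  set G : Ico (0 : ℝ) 1 → ℝ := fun t =>
    ((1 - b * (t : ℝ)) ^ m)⁻¹ * (β * (t : ℝ) * (1 - (t : ℝ) * b) ^ (-(β + 1))) with hG
  have hbt (t : Ico (0 : ℝ) 1) : 1 - b ≤ 1 - b * (t : ℝ) := by nlinarith [t.2.2]
  have hG0 (t : Ico (0 : ℝ) 1) : 0 ≤ G t := by
    have := hbt t
    have h1 : 0 ≤ 1 - b * (t : ℝ) := by linarith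
    have h2 : 0 ≤ 1 - (t : ℝ) * b := by linarith
    have := t.2.1
    positivity
  have hGeq : deriv g b = ((∫ t, G t ∂μ : ℝ) : ℂ) := by
    rw [hderiv, ← integral_complex_ofReal]
    refine integral_congr_ae (Filter.Eventually.of_forall fun t => ?_)
    have h2 : 0 ≤ 1 - (t : ℝ) * b := by linarith [hbt t]
    simp only [hG, Complex.ofReal_mul, Complex.ofReal_inv, Complex.ofReal_pow, Complex.ofReal_sub,
      Complex.ofReal_one, Complex.ofReal_cpow h2]
  have hGcont : Continuous G := by
    refine Continuous.mul (Continuous.inv₀ (by fun_prop) fun t => ?_)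
      (Continuous.mul (by fun_prop) (Continuous.rpow_const (by fun_prop) fun t => Or.inl ?_))
    · exact pow_ne_zero _ (by linarith [hbt t])
    · linarith [hbt t]
  have hGint : Integrable G μ := by
    refine Integrable.of_bound hGcont.aestronglyMeasurable
      (((1 - b) ^ m)⁻¹ * (β * (1 - b) ^ (-(β + 1)))) (Filter.Eventually.of_forall fun t => ?_)
    rw [Real.norm_of_nonneg (hG0 t)]
    have h1 := hbt t
    have h2 : 1 - b ≤ 1 - (t : ℝ) * b := by linarith
    have h3 : (1 - (t : ℝ) * b) ^ (-(β + 1)) ≤ (1 - b) ^ (-(β + 1)) :=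
      Real.rpow_le_rpow_of_nonpos hu h2 (by linarith)
    have h4 : 0 ≤ (1 - (t : ℝ) * b) ^ (-(β + 1)) := Real.rpow_nonneg (by linarith) _
    have h5 : β * (t : ℝ) ≤ β := mul_le_of_le_one_right hβ.le t.2.2.le
    have := t.2.1
    simp only [hG]
    gcongr
  rw [hGeq, Complex.norm_real, Real.norm_of_nonneg (integral_nonneg hG0),
    ofReal_integral_eq_lintegral_ofReal hGint (Filter.Eventually.of_forall hG0)]
  have hS : MeasurableSet {t : Ico (0 : ℝ) 1 | b ≤ (t : ℝ)} :=
    measurableSet_le (by fun_prop) (by fun_prop)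
  rw [← setLIntegral_const]
  refine (setLIntegral_mono' hS fun t ht => ENNReal.ofReal_le_ofReal ?_).trans
    (setLIntegral_le_lintegral _ _)
  have ht' : b ≤ (t : ℝ) := ht
  have h1 : 0 < 1 - b * (t : ℝ) := by linarith [hbt t]
  have h2 : 1 - b * (t : ℝ) ≤ 2 * (1 - b) := by nlinarith
  simp only [hG]
  calc β / 2 * (2 * (1 - b)) ^ (-((m : ℝ) + β + 1))
      ≤ (β * (t : ℝ)) * (1 - b * (t : ℝ)) ^ (-((m : ℝ) + β + 1)) := by
        refine mul_le_mul ?_ (Real.rpow_le_rpow_of_nonpos h1 h2 ?_) (by positivity)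
          (mul_nonneg hβ.le t.2.1)
        · nlinarith
        · have : (0 : ℝ) ≤ m := m.cast_nonneg
          linarith
    _ = _ := by
        rw [show -((m : ℝ) + β + 1) = -(m : ℝ) + -(β + 1) by ring, Real.rpow_add h1,
          Real.rpow_neg h1.le, Real.rpow_natCast, mul_comm (t : ℝ) b]
        ring

end TestFunction

theorem isCarleson_of_hilbertBounded {p q q' α β : ℝ} (hqq : q.HolderConjugate q') (hp : 0 < p)
    (hα : p - 1 < α) (hβ : 0 < β) {μ : Measure (Ico (0 : ℝ) 1)} [IsFiniteMeasure μ]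
    (h : HilbertBounded μ β p α q (β - 1)) :
    IsCarleson ((α + 2) / p + (β + 1) / q' - 1) μ := by
  have hq0 := hqq.pos
  have hq'0 := hqq.symm.pos
  have hconj := hqq.inv_add_inv_eq_one
  set s := (α + 2) / p + (β + 1) / q' - 1 with hs
  have hs0 : 0 < s := by
    have h1 : 1 < (α + 2) / p := by rw [one_lt_div hp]; linarith
    have h2 : 0 < (β + 1) / q' := by positivity
    linarith
  -- Any `m` this large makes the norm estimate for the test functions available; `m` cancels from
  -- the final exponent.
  obtain ⟨m, hm⟩ := exists_nat_gt ((α + 2) / p)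
  have hm' : α + 2 < ((m : ℝ) + 1) * p := by
    rw [div_lt_iff₀ hp] at hm
    linarith
  obtain ⟨CH, hCH⟩ := h
  obtain ⟨C₁, hC₁, hnorm⟩ := dirichletNorm_testFunction_le hp (by linarith) hm'
  obtain ⟨C₂, hC₂, hpt⟩ := norm_rpow_mul_one_sub_rpow_le hq0 (β - 1)
  set K : ℝ≥0∞ := (C₂ * ENNReal.ofReal (1 / β)) ^ (1 / q) * (CH * C₁) with hK
  have hKfin : K ≠ ∞ := ENNReal.mul_ne_top (ENNReal.rpow_ne_top_of_nonneg (by positivity)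
    (ENNReal.mul_ne_top hC₂ ENNReal.ofReal_ne_top)) (ENNReal.mul_ne_top ENNReal.coe_ne_top hC₁)
  set c : ℝ := β / 2 * 2 ^ (-((m : ℝ) + β + 1)) with hc
  have hc0 : 0 < c := by positivity
  have hmain (b : ℝ) (hb0 : 1 / 2 ≤ b) (hb1 : b < 1) :
      μ {t : Ico (0 : ℝ) 1 | b ≤ (t : ℝ)} ≤ ENNReal.ofReal (K.toReal / c * (1 - b) ^ s) := by
    have hb : 0 < b := by linarith
    have hu : 0 < 1 - b := by linarith
    have hbD : (b : ℂ) ∈ unitDisc := ofReal_mem_unitDisc hb.le hb1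
    have hbn : ‖(b : ℂ)‖ = b := by rw [Complex.norm_real, Real.norm_of_nonneg hb.le]
    have hfN := hnorm b hb hb1
    obtain ⟨g, hg, hgD, hgN⟩ := hCH (fun z : ℂ => ((1 - (b : ℂ) * z) ^ m)⁻¹)
      ⟨(differentiableOn_testFunction m hb).mono (unitDisc_subset_ball hb hb1),
        hfN.trans_lt (ENNReal.mul_lt_top hC₁.lt_top ENNReal.ofReal_lt_top)⟩
    have hlow := measure_mul_le_norm_deriv m hb0 hb1 hβ hg
    have hup : ENNReal.ofReal (‖deriv g b‖ * (1 - b) ^ ((β + 1) / q)) ≤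
        K * ENNReal.ofReal ((1 - b) ^ ((α + 2) / p - (m + 1))) := by
      have h1 := (hpt _ (differentiableOn_deriv hgD.1) _ hbD).trans
        (mul_le_mul' le_rfl ((setLIntegral_le_lintegral _ _).trans
          (lintegral_deriv_le_dirichletNorm_rpow hq0 (by linarith) g)))
      rw [hbn, sub_add_cancel, ← mul_assoc, show β - 1 + 2 = β + 1 by ring] at h1
      have h2 := ENNReal.rpow_le_rpow h1 (show 0 ≤ 1 / q by positivity)
      rw [ENNReal.mul_rpow_of_nonneg _ _ (show 0 ≤ 1 / q by positivity), ← ENNReal.rpow_mul,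
        mul_one_div_cancel hq0.ne', ENNReal.rpow_one,
        ENNReal.ofReal_rpow_of_nonneg (by positivity) (by positivity),
        Real.mul_rpow (by positivity) (by positivity), ← Real.rpow_mul (norm_nonneg _),
        mul_one_div_cancel hq0.ne', Real.rpow_one, ← Real.rpow_mul hu.le, mul_one_div] at h2
      refine h2.trans ?_
      rw [hK, mul_assoc _ (_ * C₁), mul_assoc _ C₁]
      exact mul_le_mul' le_rfl (hgN.trans (mul_le_mul' le_rfl hfN))
    set A : ℝ := c * (1 - b) ^ (-((m : ℝ) + β + 1) + (β + 1) / q) with hA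
    have hA0 : 0 < A := by positivity
    have h3 : μ {t : Ico (0 : ℝ) 1 | b ≤ (t : ℝ)} * ENNReal.ofReal A ≤
        K * ENNReal.ofReal ((1 - b) ^ ((α + 2) / p - (m + 1))) := by
      refine le_trans ?_ hup
      rw [ENNReal.ofReal_mul (norm_nonneg _)]
      refine le_trans (le_of_eq ?_) (mul_le_mul' hlow le_rfl)
      rw [mul_right_comm, ← ENNReal.ofReal_mul (by positivity), mul_comm]
      congr 2
      rw [hA, hc, Real.mul_rpow zero_le_two hu.le, Real.rpow_add hu]
      ring
    have h4 := mul_le_mul' h3 (le_refl (ENNReal.ofReal A⁻¹))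
    rw [mul_assoc, ← ENNReal.ofReal_mul hA0.le, mul_inv_cancel₀ hA0.ne', ENNReal.ofReal_one,
      mul_one, ← ENNReal.ofReal_toReal hKfin, ← ENNReal.ofReal_mul (by positivity),
      ← ENNReal.ofReal_mul (by positivity)] at h4
    refine h4.trans_eq ?_
    congr 1
    have hexp : s = ((α + 2) / p - (m + 1)) + -(-((m : ℝ) + β + 1) + (β + 1) / q) := by
      rw [hs, div_eq_mul_inv (β + 1) q, div_eq_mul_inv (β + 1) q']
      linear_combination (β + 1) * hconj
    rw [hexp, Real.rpow_add hu, hA, mul_inv, ← Real.rpow_neg hu.le]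
    ring
  refine ⟨K.toReal / c + (μ univ).toReal * 2 ^ s + 1, by positivity, fun t ht0 ht1 => ?_⟩
  have hu : 0 < 1 - t := by linarith
  rcases le_or_gt (1 / 2) t with ht | ht
  · refine (hmain t ht ht1).trans (ENNReal.ofReal_le_ofReal ?_)
    gcongr
    have : 0 ≤ (μ univ).toReal * 2 ^ s := by positivity
    linarith
  · refine (measure_mono (subset_univ _)).trans ?_
    refine (ENNReal.ofReal_toReal (measure_ne_top μ univ)).symm.trans_le
      (ENNReal.ofReal_le_ofReal ?_)
    have h1 : 1 ≤ 2 ^ s * (1 - t) ^ s := by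
      rw [← Real.mul_rpow zero_le_two hu.le]
      exact Real.one_le_rpow (by linarith) hs0.le
    have h2 : 0 ≤ K.toReal / c := by positivity
    calc (μ univ).toReal ≤ (μ univ).toReal * (2 ^ s * (1 - t) ^ s) :=
          le_mul_of_one_le_right ENNReal.toReal_nonneg h1
      _ = ((μ univ).toReal * 2 ^ s) * (1 - t) ^ s := by ring
      _ ≤ _ := by
          gcongr
          linarith

theorem StandingCondition.isFiniteMeasure {p α : ℝ} (hp : 0 < p) {μ : Measure (Ico (0 : ℝ) 1)}
    (h : StandingCondition p α μ) : IsFiniteMeasure μ := by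
  obtain ⟨h₁, h₂, h₃⟩ := h
  rcases le_total p 1 with h1 | h1
  · exact (h₁ hp h1).isFiniteMeasure
  · rcases le_total p 2 with h2 | h2
    · exact (h₂ h1 h2).isFiniteMeasure
    · exact (h₃ h2).isFiniteMeasure

end GenHilbert

theorem theorem4p3 (p q q' α β : ℝ) (hq : 1 < q) (hqq' : 1 / q + 1 / q' = 1)
    (hp : 0 < p) (hpq : p ≤ q) (hα : p - 1 < α) (hβ : q < β)
    (μ : MeasureTheory.Measure (Set.Ico (0 : ℝ) 1))
    (hμ : GenHilbert.StandingCondition p α μ) :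
    (GenHilbert.HilbertBounded μ β p α q (β - 1) →
      GenHilbert.IsCarleson ((α + 2) / p + (β + 1) / q' - 1) μ) ∧
    (GenHilbert.IsCarleson (max (α + 2 - p) (β + 1) * (1 / p + 1 / q')) μ →
      GenHilbert.HilbertBounded μ β p α q (β - 1)) := by
  have hqq : q.HolderConjugate q' :=
    Real.holderConjugate_iff.2 ⟨hq, by simpa only [one_div] using hqq'⟩
  have := hμ.isFiniteMeasure hp
  have hβ0 : 0 < β := by linarith
  exact ⟨GenHilbert.isCarleson_of_hilbertBounded hqq hp hα hβ0,
    GenHilbert.hilbertBounded_of_isCarleson hqq hp hpq hα hβ0⟩
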